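/- **Setting.** Let $\ell\le r$ be integers, $\underline a=(a_i)_{\ell\le i\le r}\in\{L,R\}^{[\ell..r]}$ and $\underline b=(b_i)_{\ell\le i\le r}\in\{+,-\}^{[\ell..r]}$. The rail yard graph $G=\mathrm{RYG}(\ell,r,\underline a,\underline b)$ has vertex set $[2\ell-1..2r+1]\times(\mathbb Z+\tfrac12)$; each even vertex $(2i,y)$, $\ell\le i\le r$, is joined by horizontal edges to $(2i-1,y)$ and $(2i+1,y)$ and by a diagonal edge to $(2i-1,y+b_i)$ if $a_i=L$, and to $(2i+1,y+b_i)$ if $a_i=R$ (with $\pm$ read as $\pm1$). The left and right boundaries consist of the vertices of abscissa $2\ell-1$ and $2r+1$ respectively. An admissible dimer covering $C$ is a matching of $G$ covering all vertices not on the boundaries and only finitely many diagonal edges, for which there is an integer $N\ge0$ such that $(2\ell-1,y)$ is covered for $y>N$ and uncovered for $y<-N$, and $(2r+1,y)$ is covered for $y<-N$ and uncovered for $y>N$; it is pure if one can take $N=0$. Its weight is $w(C)=\prod_{i=\ell}^r x_i^{d_i(C)}$, where the $x_i$ are formal variables and $d_i(C)$ is the number of covered diagonal edges incident to an even vertex of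 abscissa $2i$. A Maya diagram is an element $\mathbf m\in\{\bullet,\circ\}^{\mathbb Z+1/2}$ with $\mathbf m_k=\bullet$ for $k\to-\infty$ and $\mathbf m_k=\circ$ for $k\to+\infty$; $\emptyset$ is the one with $\mathbf m_k=\bullet$ exactly for $k<0$. The left boundary state of $C$ has $\circ$ at $k$ iff $(2\ell-1,k)$ is covered; the right boundary state has $\bullet$ at $k$ iff $(2r+1,k)$ is covered. The Fock space $\mathcal F$ has basis $|\mathbf m\rangle$ indexed by Maya diagrams, with dual basis $\langle\mathbf m|$. Write $\mathbf m^{(k)}$ for $\mathbf m$ with the colour at site $k$ inverted. The operator $\psi_k$ (resp. $\psi_k^*$) sends $|\mathbf m\rangle$ to $(-1)^{\#\{j>k:\,\mathbf m_j=\bullet\}}|\mathbf m^{(k)}\rangle$ if $\mathbf m_k=\circ$ (resp. $\mathbf m_k=\bullet$), and to $0$ otherwise. Maya diagrams correspond bijectively to charged partitions $(\lambda,c)$, with $\lambda$ a partition and $c\in\mathbb Z$, the black marbles being at the positions $\lambda_i+c-i+\tfrac12$, $i\ge1$. For partitions write $\lambda\succ\mu$ if $\lambda_1\ge\mu_1\ge\lambda_2\ge\mu_2\ge\cdots$,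 and let $\lambda'$ be the conjugate of $\lambda$. The operators $\Gamma_{ab}(x)$ preserve $c$ and act on $\lambda$ by $$\Gamma_{L+}(x)|\lambda\rangle=\sum_{\mu\prec\lambda}x^{|\lambda|-|\mu|}|\mu\rangle,\quad \Gamma_{R+}(x)|\lambda\rangle=\sum_{\mu'\prec\lambda'}x^{|\lambda|-|\mu|}|\mu\rangle,\quad \Gamma_{L-}(x)|\lambda\rangle=\sum_{\mu\succ\lambda}x^{|\mu|-|\lambda|}|\mu\rangle,\quad \Gamma_{R-}(x)|\lambda\rangle=\sum_{\mu'\succ\lambda'}x^{|\mu|-|\lambda|}|\mu\rangle .$$ Products of operators are taken as formal power series in the $x_i$ with operator coefficients. **Theorem (Constrained transfer matrix decomposition).** Let $E$ be a finite set of edges of $G$. For $\ell\le i\le r$ let $(\alpha_{i,1},\beta_{i,1}),\dots,(\alpha_{i,m_i},\beta_{i,m_i})$ be the edges of $E$ joining abscissas $2i$ and $2i-1$, and $(\gamma_{i,1},\delta_{i,1}),\dots,(\gamma_{i,m_i'},\delta_{i,m_i'})$ those joining abscissas $2i$ and $2i+1$ (even endpoint first, each list without repetition and in an arbitrary order), let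 $n_i$ be the number of diagonal edges of $E$ with an endpoint of abscissa $2i$, and write $v^{\mathrm y}$ for the ordinate of a vertex $v$. Put $$T_i=(-1)^{k_i}x_i^{n_i}\Bigl(\prod_{j=1}^{m_i}\psi^*_{\beta_{i,j}^{\mathrm y}}\Bigr)\Bigl(\prod_{j=1}^{m_i}\psi_{\alpha_{i,j}^{\mathrm y}}\Bigr)\Bigl(\prod_{j=1}^{m_i'}\psi_{\gamma_{i,j}^{\mathrm y}}\Bigr)\Gamma_{Rb_i}(x_i)\Bigl(\prod_{j=1}^{m_i'}\psi^*_{\delta_{i,j}^{\mathrm y}}\Bigr),\qquad k_i=\tfrac{m_i(m_i-1)}2+\tfrac{m_i'(m_i'-1)}2,$$ if $a_i=R$, and $$T_i=(-1)^{k_i}x_i^{n_i}\Bigl(\prod_{j=1}^{m_i}\psi^*_{\beta_{i,j}^{\mathrm y}}\Bigr)\Gamma_{Lb_i}(x_i)\Bigl(\prod_{j=1}^{m_i}\psi_{\alpha_{i,j}^{\mathrm y}}\Bigr)\Bigl(\prod_{j=1}^{m_i'}\psi_{\gamma_{i,j}^{\mathrm y}}\Bigr)\Bigl(\prod_{j=1}^{m_i'}\psi^*_{\delta_{i,j}^{\mathrm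 y}}\Bigr),\qquad k_i=\tfrac{m_i(m_i-1)}2+\tfrac{m_i'(m_i'-1)}2+n_i,$$ if $a_i=L$ (products in increasing order of $j$). Then, as formal power series in the $x_i$, $$\sum_{C\text{ pure},\ C\supseteq E}w(C)=\langle\emptyset|T_\ell T_{\ell+1}\cdots T_r|\emptyset\rangle,$$ and more generally, for all Maya diagrams $\mathbf l,\mathbf r$, the sum of $w(C)$ over all admissible dimer coverings $C\supseteq E$ with left boundary state $\mathbf l$ and right boundary state $\mathbf r$ equals $\langle\mathbf l|T_\ell T_{\ell+1}\cdots T_r|\mathbf r\rangle$. -/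

import Mathlib

open scoped MvPowerSeries.WithPiTopology

namespace RailYard

/-! ### Rail yard graphs

A half-integer `n + 1/2` is encoded by the integer `n` throughout: ordinates of vertices and
sites of Maya diagrams. In particular a half-integer is positive when its code is `≥ 0` and
negative when its code is `< 0`. -/

/-- The symbols of an LR sequence. -/
inductive LR
  | L
  | R

/-- The symbols of a sign sequence. -/
inductive Sgn
  | plus
  | minus

/-- The integer `+1` or `-1` attached to a sign. -/
def Sgn.toInt : Sgn → ℤ
  | .plus => 1
  | .minus => -1

/-- The point `(x, y)` stands for the point with abscissa `x` and ordinate `y + 1/2`. -/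
abbrev Vertex := ℤ × ℤ

/-- The odd endpoint of the diagonal edge at the even vertex `(2 * m, y)`. -/
def diagNbr (a : ℤ → LR) (b : ℤ → Sgn) (m y : ℤ) : Vertex :=
  match a m with
  | .L => (2 * m - 1, y + (b m).toInt)
  | .R => (2 * m + 1, y + (b m).toInt)

/-- `(α, β)` is an edge of the rail yard graph, `α` being its even and `β` its odd endpoint. -/
def IsEdge (ℓ r : ℤ) (a : ℤ → LR) (b : ℤ → Sgn) (α β : Vertex) : Prop :=
  ∃ m y : ℤ, ℓ ≤ m ∧ m ≤ r ∧ α = (2 * m, y) ∧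
    (β = (2 * m - 1, y) ∨ β = (2 * m + 1, y) ∨ β = diagNbr a b m y)

/-- The rail yard graph. Its vertices are the points with abscissa in `[2ℓ-1 .. 2r+1]`; the other
points of the ambient lattice are isolated, hence never covered by a dimer. -/
def ryg (ℓ r : ℤ) (a : ℤ → LR) (b : ℤ → Sgn) : SimpleGraph Vertex :=
  SimpleGraph.fromRel (IsEdge ℓ r a b)

/-- The possible diagonal edges in column `i`, i.e. at even vertices with abscissa `2 * i`. -/
def diagonals (a : ℤ → LR) (b : ℤ → Sgn) (i : ℤ) : Set (Sym2 Vertex) :=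
  {e | ∃ y : ℤ, e = s((2 * i, y), diagNbr a b i y)}

/-! ### Maya diagrams and charged partitions -/

/-- A Maya diagram, given by the set of sites occupied by a black marble. -/
@[ext]
structure MayaDiagram where
  black : Set ℤ
  eventually_black : ∀ᶠ k in Filter.atBot, k ∈ black
  eventually_white : ∀ᶠ k in Filter.atTop, k ∉ black

/-- The Maya diagram `∅`: black marbles on the negative sites, white ones on the positive sites. -/
def vacuum : MayaDiagram where
  black := {k | k < 0}
  eventually_black := Filter.eventually_lt_atBot 0
  eventually_white := (Filter.eventually_ge_atTop 0).mono fun _ h => not_lt.2 h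

/-- The Maya diagram obtained by inverting the colour of the marble on site `k`. -/
def MayaDiagram.flip (k : ℤ) (m : MayaDiagram) : MayaDiagram where
  black := {j | (j ≠ k ∧ j ∈ m.black) ∨ (j = k ∧ j ∉ m.black)}
  eventually_black := by
    filter_upwards [m.eventually_black, Filter.eventually_lt_atBot k] with j hj hk
    exact Or.inl ⟨hk.ne, hj⟩
  eventually_white := by
    filter_upwards [m.eventually_white, Filter.eventually_gt_atTop k] with j hj hk
    rintro (h | h)
    · exact hj h.2
    · exact hk.ne' h.1

/-- The position `k_{i+1} = λ_{i+1} + c - (i + 1) + 1/2` of the `(i+1)`-st black marble, counted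
downwards, in the Maya diagram of the charged partition `(λ, c)`. Here `λ_{i+1} = rowLen i`. -/
def blackPos (p : YoungDiagram × ℤ) (i : ℕ) : ℤ :=
  (p.1.rowLen i : ℤ) + p.2 - i - 1

theorem blackPos_strictAnti (p : YoungDiagram × ℤ) : StrictAnti (blackPos p) := by
  intro i j hij
  have h := p.1.rowLen_anti i j hij.le
  unfold blackPos
  omega

theorem exists_rowLen_eq_zero (μ : YoungDiagram) : ∃ n, ∀ i, n ≤ i → μ.rowLen i = 0 := by
  refine ⟨μ.colLen 0, fun i hi => ?_⟩
  by_contra h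
  have h1 : (i, 0) ∈ μ := YoungDiagram.mem_iff_lt_rowLen.2 (Nat.pos_of_ne_zero h)
  exact absurd (YoungDiagram.mem_iff_lt_colLen.1 h1) (not_lt.2 hi)

/-- The Maya diagram of a charged partition. -/
def mayaOf (p : YoungDiagram × ℤ) : MayaDiagram where
  black := Set.range (blackPos p)
  eventually_black := by
    obtain ⟨n, hn⟩ := exists_rowLen_eq_zero p.1
    filter_upwards [Filter.eventually_le_atBot (p.2 - n - 1)] with k hk
    refine ⟨(p.2 - k - 1).toNat, ?_⟩
    have h := hn (p.2 - k - 1).toNat (by omega)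
    unfold blackPos
    rw [h]
    omega
  eventually_white := by
    filter_upwards [Filter.eventually_gt_atTop (blackPos p 0)] with k hk
    rintro ⟨i, rfl⟩
    exact absurd ((blackPos_strictAnti p).antitone (Nat.zero_le i)) (not_le.2 hk)

theorem mayaOf_injective : Function.Injective mayaOf := by
  rintro ⟨μ, c⟩ ⟨ν, d⟩ h
  have hr : Set.range (blackPos (μ, c)) = Set.range (blackPos (ν, d)) :=
    congrArg MayaDiagram.black h
  have hn : Set.range (fun i => - blackPos (μ, c) i) = Set.range (fun i => - blackPos (ν, d) i) := by
    have h1 := congrArg (fun s => (fun x : ℤ => -x) '' s) hr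
    simpa only [← Set.range_comp, Function.comp_def] using h1
  have hs : ∀ p, StrictMono (fun i => - blackPos p i) := fun p i j hij =>
    neg_lt_neg (blackPos_strictAnti p hij)
  have hf := ((hs _).range_inj (hs _)).1 hn
  have hv : ∀ i, (μ.rowLen i : ℤ) + c = ν.rowLen i + d := fun i => by
    have := congrFun hf i
    simp only [blackPos] at this
    omega
  obtain ⟨n, hn⟩ := exists_rowLen_eq_zero μ
  obtain ⟨n', hn'⟩ := exists_rowLen_eq_zero ν
  have hcd : c = d := by
    have := hv (max n n')
    rw [hn _ (le_max_left _ _), hn' _ (le_max_right _ _)] at this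
    simpa using this
  subst hcd
  refine Prod.ext ?_ rfl
  refine SetLike.ext ?_
  rintro ⟨i, j⟩
  have h1 : μ.rowLen i = ν.rowLen i := by
    have := hv i
    omega
  change (i, j) ∈ μ ↔ (i, j) ∈ ν
  rw [YoungDiagram.mem_iff_lt_rowLen, YoungDiagram.mem_iff_lt_rowLen, h1]

/-- A nonincreasing, eventually vanishing sequence of natural numbers is a partition. -/
theorem exists_rowLen_eq (f : ℕ → ℕ) (hf : Antitone f) (t : ℕ) (ht : ∀ i, t ≤ i → f i = 0) :
    ∃ μ : YoungDiagram, ∀ i, μ.rowLen i = f i := by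
  let μ : YoungDiagram :=
    { cells := (Finset.range t ×ˢ Finset.range (f 0)).filter fun x => x.2 < f x.1
      isLowerSet := by
        rintro ⟨i, j⟩ ⟨i', j'⟩ ⟨h1, h2⟩ hx
        simp only at h1 h2
        simp only [Finset.coe_filter, Finset.mem_product, Finset.mem_range, Set.mem_ofPred_eq]
          at hx ⊢
        have := hf h1
        omega }
  have hμ : ∀ i j, (i, j) ∈ μ ↔ j < f i := by
    intro i j
    rw [← YoungDiagram.mem_cells]
    simp only [μ, Finset.mem_filter, Finset.mem_product, Finset.mem_range]
    constructor
    · exact fun h => h.2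
    · intro h
      have h0 := hf (Nat.zero_le i)
      have h1 : i < t := by
        by_contra h2
        have := ht i (not_lt.1 h2)
        omega
      omega
  refine ⟨μ, fun i => ?_⟩
  have h : ∀ j, j < μ.rowLen i ↔ j < f i := fun j => by
    rw [← YoungDiagram.mem_iff_lt_rowLen, hμ]
  have h1 := h (f i)
  have h2 := h (μ.rowLen i)
  omega

theorem mayaOf_surjective : Function.Surjective mayaOf := by
  classical
  intro m
  obtain ⟨M, hM⟩ := Filter.eventually_atTop.1 m.eventually_white
  obtain ⟨N, hN⟩ := Filter.eventually_atBot.1 m.eventually_black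
  let p : ℕ → Prop := fun j => M - j ∈ m.black
  let J : ℕ := (M - N).toNat
  have hp : ∀ j, J ≤ j → p j := fun j hj => hN _ (by omega)
  have hinf : (Set.ofPred p).Infinite := by
    refine Set.infinite_of_not_bddAbove ?_
    rintro ⟨B, hB⟩
    have := hB (hp (max J (B + 1)) (le_max_left _ _))
    have := le_max_right J (B + 1)
    omega
  let t : ℕ := Nat.count p J
  have hcount : ∀ s, Nat.count p (J + s) = t + s := by
    intro s
    induction s with
    | zero => rfl
    | succ s ih =>
      rw [← Nat.add_assoc, Nat.count_succ, ih, if_pos (hp _ (by omega)), Nat.add_assoc]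
  have hnth : ∀ s, Nat.nth p (t + s) = J + s := fun s => by
    rw [← hcount s]
    exact Nat.nth_count (hp _ (by omega))
  have hmono := Nat.nth_strictMono hinf
  have hstep : ∀ i j : ℕ, i ≤ j → Nat.nth p i + (j - i) ≤ Nat.nth p j := by
    intro i j hij
    induction j, hij using Nat.le_induction with
    | base => simp
    | succ j hij ih =>
      have := hmono (Nat.lt_add_one j)
      omega
  have hle : ∀ i, Nat.nth p i + t ≤ J + i := by
    intro i
    have h1 := hstep i (t + i) (by omega)
    have h2 := hnth i
    omega
  have heq : ∀ i, t ≤ i → Nat.nth p i + t = J + i := by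
    intro i hi
    have h2 := hnth (i - t)
    rw [Nat.add_sub_cancel' hi] at h2
    omega
  obtain ⟨μ, hμ⟩ := exists_rowLen_eq (fun i => J + i - t - Nat.nth p i)
    (by
      intro i j hij
      have h1 := hstep i j hij
      have h2 := hle i
      have h3 := hle j
      simp only
      omega)
    t (by
      intro i hi
      have := heq i hi
      omega)
  refine ⟨(μ, M - J + t + 1), ?_⟩
  have hpos : ∀ i, blackPos (μ, M - J + t + 1) i = M - Nat.nth p i := by
    intro i
    have h1 := hμ i
    have h2 := hle i
    simp only [blackPos, h1]
    omega
  refine MayaDiagram.ext (Set.ext fun k => ?_)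
  change k ∈ Set.range (blackPos (μ, M - J + t + 1)) ↔ _
  constructor
  · rintro ⟨i, rfl⟩
    rw [hpos]
    exact Nat.nth_mem_of_infinite hinf i
  · intro hk
    have hkM : k < M := by
      by_contra h
      exact hM k (not_lt.1 h) hk
    have hpk : p (M - k).toNat := by
      change M - ((M - k).toNat : ℤ) ∈ m.black
      have : M - ((M - k).toNat : ℤ) = k := by omega
      rwa [this]
    refine ⟨Nat.count p (M - k).toNat, ?_⟩
    rw [hpos, Nat.nth_count hpk]
    omega

/-- The bijection between charged partitions and Maya diagrams. -/
noncomputable def chargedEquiv : YoungDiagram × ℤ ≃ MayaDiagram :=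
  Equiv.ofBijective mayaOf ⟨mayaOf_injective, mayaOf_surjective⟩

/-! ### Interlacing and the vertex operators -/

/-- `λ ≻ μ`, i.e. `λ₁ ≥ μ₁ ≥ λ₂ ≥ μ₂ ≥ ⋯`. -/
def Interlaced (lam mu : YoungDiagram) : Prop :=
  ∀ i, mu.rowLen i ≤ lam.rowLen i ∧ lam.rowLen (i + 1) ≤ mu.rowLen i

/-- `|μ⟩` appears in `Γ_{ab}(x)|λ⟩` with coefficient `x ^ d`. -/
def VertexRel : LR → Sgn → ℕ → YoungDiagram → YoungDiagram → Prop
  | .L, .plus, d, lam, mu => Interlaced lam mu ∧ lam.card = mu.card + d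
  | .R, .plus, d, lam, mu => Interlaced lam.transpose mu.transpose ∧ lam.card = mu.card + d
  | .L, .minus, d, lam, mu => Interlaced mu lam ∧ mu.card = lam.card + d
  | .R, .minus, d, lam, mu => Interlaced mu.transpose lam.transpose ∧ mu.card = lam.card + d

theorem finite_card_le (n : ℕ) : {mu : YoungDiagram | mu.card ≤ n}.Finite := by
  have hinj : Function.Injective YoungDiagram.cells := fun _ _ h => YoungDiagram.ext h
  refine Set.Finite.subset (Set.Finite.preimage hinj.injOn
    (Finset.finite_toSet ((Finset.range n ×ˢ Finset.range n).powerset))) ?_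
  intro mu hmu
  simp only [Set.mem_ofPred_eq] at hmu
  simp only [Set.mem_preimage, Finset.mem_coe, Finset.mem_powerset]
  rintro ⟨i, j⟩ hij
  have hij' : (i, j) ∈ mu := hij
  have h1 : mu.colLen j ≤ mu.card := by
    rw [mu.colLen_eq_card]
    exact Finset.card_le_card (Finset.filter_subset _ _)
  have h2 : mu.rowLen i ≤ mu.card := by
    rw [mu.rowLen_eq_card]
    exact Finset.card_le_card (Finset.filter_subset _ _)
  have h3 := YoungDiagram.mem_iff_lt_colLen.1 hij'
  have h4 := YoungDiagram.mem_iff_lt_rowLen.1 hij'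
  simp only [Finset.mem_product, Finset.mem_range]
  omega

theorem finite_vertexRel (a : LR) (b : Sgn) (d : ℕ) (lam : YoungDiagram) :
    {mu | VertexRel a b d lam mu}.Finite := by
  refine (finite_card_le (lam.card + d)).subset fun mu hmu => ?_
  simp only [Set.mem_ofPred_eq] at hmu ⊢
  cases a <;> cases b <;> (have h := hmu.2; omega)

/-- The fermionic Fock space over the coefficient ring `R`, with basis the Maya diagrams. -/
abbrev Fock (R : Type*) [CommRing R] := MayaDiagram →₀ R

/-- The basis vector `|m⟩`. -/
noncomputable def ket (R : Type*) [CommRing R] (m : MayaDiagram) : Fock R :=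
  Finsupp.single m 1

/-- The coefficient of `x ^ d` in `Γ_{ab}(x)`, acting on the Fock space: each subspace of fixed
charge is identified with the bosonic Fock space through `chargedEquiv`. -/
noncomputable def vertexCoeff (R : Type*) [CommRing R] (a : LR) (b : Sgn) (d : ℕ) :
    Module.End R (Fock R) :=
  Finsupp.linearCombination R fun m =>
    ∑ mu ∈ (finite_vertexRel a b d (chargedEquiv.symm m).1).toFinset,
      ket R (chargedEquiv (mu, (chargedEquiv.symm m).2))

/-- Formal power series in commuting variables `x_i`, `i ∈ ℤ`, whose coefficients are operators on
the Fock space (the variables commute with the operators). -/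
abbrev FormalOp (R : Type*) [CommRing R] := MvPowerSeries ℤ (Module.End R (Fock R))

/-- The vertex operator `Γ_{ab}(x_i) = ∑ d, vertexCoeff d * x_i ^ d`. -/
noncomputable def vertexOp (R : Type*) [CommRing R] (a : LR) (b : Sgn) (i : ℤ) : FormalOp R :=
  open Classical in fun n => if n = Finsupp.single i (n i) then vertexCoeff R a b (n i) else 0

/-- The sign `(-1) ^ #{j > k, m_j = •}`. -/
noncomputable def fermiSign (R : Type*) [CommRing R] (k : ℤ) (m : MayaDiagram) : R :=
  (-1) ^ Set.ncard {j | k < j ∧ j ∈ m.black}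

/-- The fermionic operator `ψ_k`. -/
noncomputable def psi (R : Type*) [CommRing R] (k : ℤ) : Module.End R (Fock R) :=
  open Classical in Finsupp.linearCombination R fun m =>
    if k ∉ m.black then fermiSign R k m • ket R (m.flip k) else 0

/-- The fermionic operator `ψ*_k`. -/
noncomputable def psiStar (R : Type*) [CommRing R] (k : ℤ) : Module.End R (Fock R) :=
  open Classical in Finsupp.linearCombination R fun m =>
    if k ∈ m.black then fermiSign R k m • ket R (m.flip k) else 0

/-- The matrix element `⟨l| T |r⟩`, a formal power series in the `x_i`. -/
noncomputable def braket {R : Type*} [CommRing R] (l : MayaDiagram) (T : FormalOp R)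
    (r : MayaDiagram) : MvPowerSeries ℤ R :=
  fun n => (MvPowerSeries.coeff n T) (ket R r) l

/-! ### Dimer coverings -/

variable {ℓ r : ℤ} {a : ℤ → LR} {b : ℤ → Sgn}

/-- The left boundary vertex at ordinate `y` is covered for `y > N` and uncovered for `y < -N`, and
the right boundary vertex is covered for `y < -N` and uncovered for `y > N`. -/
def BoundaryCondition (M : (ryg ℓ r a b).Subgraph) (N : ℕ) : Prop :=
  ∀ y : ℤ,
    ((N : ℤ) ≤ y → (2 * ℓ - 1, y) ∈ M.verts ∧ (2 * r + 1, y) ∉ M.verts) ∧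
    (y < -(N : ℤ) → (2 * ℓ - 1, y) ∉ M.verts ∧ (2 * r + 1, y) ∈ M.verts)

variable (ℓ r a b) in
/-- An admissible dimer covering. The vertices of the subgraph are the covered vertices. -/
structure AdmissibleCovering where
  dimers : (ryg ℓ r a b).Subgraph
  isMatching : dimers.IsMatching
  inner_covered : ∀ v : Vertex, 2 * ℓ - 1 < v.1 → v.1 < 2 * r + 1 → v ∈ dimers.verts
  boundary : ∃ N : ℕ, BoundaryCondition dimers N
  finite_diagonals : (dimers.edgeSet ∩ ⋃ i, diagonals a b i).Finite

namespace AdmissibleCovering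

/-- Pure dimer coverings. -/
def IsPure (C : AdmissibleCovering ℓ r a b) : Prop :=
  BoundaryCondition C.dimers 0

/-- The left boundary state: a white marble at each covered left boundary vertex. -/
def leftState (C : AdmissibleCovering ℓ r a b) : MayaDiagram where
  black := {k | (2 * ℓ - 1, k) ∉ C.dimers.verts}
  eventually_black := by
    obtain ⟨N, hN⟩ := C.boundary
    filter_upwards [Filter.eventually_lt_atBot (-(N : ℤ))] with k hk
    exact ((hN k).2 hk).1
  eventually_white := by
    obtain ⟨N, hN⟩ := C.boundary
    filter_upwards [Filter.eventually_ge_atTop (N : ℤ)] with k hk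
    exact not_not.2 ((hN k).1 hk).1

/-- The right boundary state: a black marble at each covered right boundary vertex. -/
def rightState (C : AdmissibleCovering ℓ r a b) : MayaDiagram where
  black := {k | (2 * r + 1, k) ∈ C.dimers.verts}
  eventually_black := by
    obtain ⟨N, hN⟩ := C.boundary
    filter_upwards [Filter.eventually_lt_atBot (-(N : ℤ))] with k hk
    exact ((hN k).2 hk).2
  eventually_white := by
    obtain ⟨N, hN⟩ := C.boundary
    filter_upwards [Filter.eventually_ge_atTop (N : ℤ)] with k hk
    exact ((hN k).1 hk).2

/-- The number `d_i(C)` of diagonal dimers in column `i`. -/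
noncomputable def diagCount (C : AdmissibleCovering ℓ r a b) (i : ℤ) : ℕ :=
  Set.ncard (C.dimers.edgeSet ∩ diagonals a b i)

/-- The weight `w(C) = ∏ x_i ^ d_i(C)`. -/
noncomputable def weight (R : Type*) [CommRing R] (C : AdmissibleCovering ℓ r a b) :
    MvPowerSeries ℤ R :=
  ∏ i ∈ Finset.Icc ℓ r, MvPowerSeries.X i ^ C.diagCount i

/-- The covering contains the edge set `E`. -/
def Contains (C : AdmissibleCovering ℓ r a b) (E : Finset (Sym2 Vertex)) : Prop :=
  (E : Set (Sym2 Vertex)) ⊆ C.dimers.edgeSet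

end AdmissibleCovering

/-! ### Constrained transfer matrices -/

/-- `A i` enumerates without repetition, in an arbitrary order, the edges `(α, β)` of `E` joining
the abscissas `2i` and `2i - 1`, and `D i` the edges `(γ, δ)` of `E` joining the abscissas `2i` and
`2i + 1`; the even endpoint comes first. -/
def IsColumnDecomposition (E : Finset (Sym2 Vertex)) (A D : ℤ → List (Vertex × Vertex)) : Prop :=
  ∀ i : ℤ, (A i).Nodup ∧ (D i).Nodup ∧
    (∀ α β : Vertex, (α, β) ∈ A i ↔ s(α, β) ∈ E ∧ α.1 = 2 * i ∧ β.1 = 2 * i - 1) ∧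
    (∀ γ δ : Vertex, (γ, δ) ∈ D i ↔ s(γ, δ) ∈ E ∧ γ.1 = 2 * i ∧ δ.1 = 2 * i + 1)

/-- The ordered product, over the listed edges, of the `ψ` at the ordinates of even endpoints. -/
noncomputable def psiProd (R : Type*) [CommRing R] (es : List (Vertex × Vertex)) : FormalOp R :=
  (es.map fun e => (MvPowerSeries.C (psi R e.1.2) : FormalOp R)).prod

/-- The ordered product, over the listed edges, of the `ψ*` at the ordinates of odd endpoints. -/
noncomputable def psiStarProd (R : Type*) [CommRing R] (es : List (Vertex × Vertex)) :
    FormalOp R :=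
  (es.map fun e => (MvPowerSeries.C (psiStar R e.2.2) : FormalOp R)).prod

/-- The number `n_i` of diagonal edges of `E` with an endpoint of abscissa `2 * i`. -/
noncomputable def numDiag (a : ℤ → LR) (b : ℤ → Sgn) (E : Finset (Sym2 Vertex)) (i : ℤ) : ℕ :=
  Set.ncard ((E : Set (Sym2 Vertex)) ∩ diagonals a b i)

/-- The constrained transfer matrix `T_i`. -/
noncomputable def transfer (R : Type*) [CommRing R] (a : ℤ → LR) (b : ℤ → Sgn)
    (E : Finset (Sym2 Vertex)) (A D : ℤ → List (Vertex × Vertex)) (i : ℤ) : FormalOp R :=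
  let m := (A i).length
  let m' := (D i).length
  let n := numDiag a b E i
  match a i with
  | .R =>
      (-1) ^ (m * (m - 1) / 2 + m' * (m' - 1) / 2) * MvPowerSeries.X i ^ n *
        psiStarProd R (A i) * psiProd R (A i) * psiProd R (D i) *
        vertexOp R .R (b i) i * psiStarProd R (D i)
  | .L =>
      (-1) ^ (m * (m - 1) / 2 + m' * (m' - 1) / 2 + n) * MvPowerSeries.X i ^ n *
        psiStarProd R (A i) * vertexOp R .L (b i) i * psiProd R (A i) *
        psiProd R (D i) * psiStarProd R (D i)

/-- The ordered product `T_ℓ T_{ℓ+1} ⋯ T_r`, for `ℓ ≤ r`. -/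
noncomputable def orderedProd {S : Type*} [Monoid S] (ℓ r : ℤ) (T : ℤ → S) : S :=
  ((List.range (r - ℓ + 1).toNat).map fun j : ℕ => T (ℓ + j)).prod

end RailYard

open RailYard

/-! A covering is read as a sequence of Maya diagrams, one on each odd abscissa: an interior odd
vertex is black when it is matched to the column on its left and white when it is matched to the
column on its right, and the boundary conventions agree with this rule. Column `i` is then a
one-step particle system. For `a i = R`, the even vertices matched to the right have the heights of
the black marbles of the left state, and each such marble crosses either horizontally or along a
diagonal, hence moves by `0` or by the sign `b i`. For `a i = L`, the holes do the same from right
to left. The matching condition is exactly the exclusion rule of `Strip` (`columnStrip`), and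
conversely every chain of strips comes from a covering (`ofStates`).

Three facts turn this picture into the formula.

Strips and vertex operators. Particles making at most one step keep their order, so the `n`-th
particle goes to the `n`-th particle. Hence the two states determine the set of displaced particles,
and a displacement of `d` black marbles by `+1` adds a vertical strip of `d` boxes. Time reversal
and the particle-hole symmetry (transposition) give the other three types, so the coefficient of `x
^ d` in the vertex operator has matrix element `1` exactly when a strip with `d` displaced particles
exists (`vertexRel_iff`).

Forced edges. The sign `(-1) ^ (m(m-1)/2)` reverses one of two lists of fermions, so that each
forced edge contributes a nested pair around the operator (`sandwich_cons`). Such a pair deletes the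
two ends of the edge from the two states; deleting a moving particle from a strip leaves a strip,
and putting it back is always possible (`constrainedStrip_cons`). The fermionic signs cancel for
particles, because as many of them lie beyond the source as beyond the target. For holes, the
numbers of black marbles beyond the two ends differ by the displacement, whence one extra sign per
diagonal edge and the term `n_i` in the exponent for type `L`. The deleted diagonals no longer
contribute to the vertex operator, and `x_i ^ n_i` restores them. Pairs on the side without
diagonals only test the colour of a site.

Expansion. Every matrix element of `T_i` is therefore `0` or a monomial (`coeff_transfer_apply`).
Expanding the product gives a sum over chains of states (`exists_coeff_prod_eq_sum`), and these
chains are the coverings containing `E`, with the same weights. -/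

namespace RailYard

/-! ### Strips: particles performing at most one step -/

/-- The particles located at `S` are moved injectively onto `T`: those in the finite set `D` move by
`ε`, the others stay in place. -/
structure Strip (ε : ℤ) (S T D : Set ℤ) : Prop where
  subset : D ⊆ S
  finite : D.Finite
  add_mem : ∀ k ∈ D, k + ε ∈ S → k + ε ∈ D
  mem_iff : ∀ k, k ∈ T ↔ (k ∈ S ∧ k ∉ D) ∨ k - ε ∈ D

/-- The particle located at `γ` is moved to `δ`. -/
def Moves (ε : ℤ) (S D : Set ℤ) (γ δ : ℤ) : Prop :=
  γ ∈ S ∧ (δ = γ ∧ γ ∉ D ∨ δ = γ + ε ∧ γ ∈ D)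

/-- The displacement of particles. -/
noncomputable def stripMap (ε : ℤ) (D : Set ℤ) (k : ℤ) : ℤ :=
  open Classical in if k ∈ D then k + ε else k

theorem Sgn.toInt_eq (s : Sgn) : s.toInt = 1 ∨ s.toInt = -1 := by
  cases s <;> simp [Sgn.toInt]

theorem moves_iff {ε : ℤ} {S D : Set ℤ} {γ δ : ℤ} :
    Moves ε S D γ δ ↔ γ ∈ S ∧ stripMap ε D γ = δ := by
  unfold Moves stripMap
  split_ifs with h <;> simp [h, eq_comm]

/-- Beyond `M` no site is vacant, so the vacant and occupied sites beyond `γ` and below `M`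
partition an interval. This trades a count of vacant sites for a count of particles, which a strip
preserves. -/
theorem ncard_compl_above {S : Set ℤ} {γ M : ℤ} (hγ : γ < M)
    (hM : ∀ k, M ≤ k → k ∈ S) :
    (Set.ncard {j | γ < j ∧ j ∉ S} : ℤ) + Set.ncard {j | γ < j ∧ j < M ∧ j ∈ S} = M - γ - 1 := by
  have h1 : {j | γ < j ∧ j ∉ S} ⊆ Set.Ioo γ M := fun j hj => ⟨hj.1, by
    by_contra h
    exact hj.2 (hM j (not_lt.1 h))⟩
  have h2 : {j | γ < j ∧ j < M ∧ j ∈ S} ⊆ Set.Ioo γ M := fun j hj => ⟨hj.1, hj.2.1⟩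
  have hfin := Set.finite_Ioo γ M
  rw [← Nat.cast_add, ← Set.ncard_union_eq _ (hfin.subset h1) (hfin.subset h2)]
  · have : {j | γ < j ∧ j ∉ S} ∪ {j | γ < j ∧ j < M ∧ j ∈ S} = Set.Ioo γ M := by
      refine Set.Subset.antisymm (Set.union_subset h1 h2) fun j hj => ?_
      by_cases hS : j ∈ S
      · exact Or.inr ⟨hj.1, hj.2, hS⟩
      · exact Or.inl ⟨hj.1, hS⟩
    rw [this, ← Finset.coe_Ioo, Set.ncard_coe_finset, Int.card_Ioo]
    omega
  · rw [Set.disjoint_left]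
    exact fun j hj hj' => hj.2 hj'.2.2

namespace Strip

variable {ε : ℤ} {S T D : Set ℤ}

theorem mem_iff_exists_moves (h : Strip ε S T D) (δ : ℤ) : δ ∈ T ↔ ∃ γ, Moves ε S D γ δ := by
  rw [h.mem_iff]
  constructor
  · rintro (⟨h1, h2⟩ | h1)
    · exact ⟨δ, h1, Or.inl ⟨rfl, h2⟩⟩
    · exact ⟨δ - ε, h.subset h1, Or.inr ⟨by omega, h1⟩⟩
  · rintro ⟨γ, h1, ⟨rfl, h2⟩ | ⟨rfl, h2⟩⟩
    · exact Or.inl ⟨h1, h2⟩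
    · exact Or.inr (by simpa using h2)

theorem image_eq (h : Strip ε S T D) : stripMap ε D '' S = T := by
  ext δ
  rw [h.mem_iff_exists_moves]
  simp only [moves_iff, Set.mem_image]

/-- With unit steps, order could only be lost by a particle landing on a neighbour at rest, which
`add_mem` forbids. Injectivity, the comparison of signs and the uniqueness of strips all rest on
this. -/
theorem strictMonoOn (h : Strip ε S T D) (hε : ε = 1 ∨ ε = -1) :
    StrictMonoOn (stripMap ε D) S := by
  intro j hj k hk hjk
  unfold stripMap
  rcases hε with rfl | rfl
  · split_ifs with h1 h2 h2
    · omega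
    · have : j + 1 ≠ k := by
        rintro rfl
        exact h2 (h.add_mem j h1 hk)
      omega
    · omega
    · omega
  · split_ifs with h1 h2 h2
    · omega
    · omega
    · have : k + -1 ≠ j := by
        rintro rfl
        exact h1 (h.add_mem k h2 hj)
      omega
    · omega

theorem moves_injective (h : Strip ε S T D) (hε : ε = 1 ∨ ε = -1) {γ γ' δ : ℤ}
    (h1 : Moves ε S D γ δ) (h2 : Moves ε S D γ' δ) : γ = γ' := by
  rw [moves_iff] at h1 h2
  exact (h.strictMonoOn hε).injOn h1.1 h2.1 (h1.2.trans h2.2.symm)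

/-- The particles beyond a given one are moved to the particles beyond its image. -/
theorem ncard_above (h : Strip ε S T D) (hε : ε = 1 ∨ ε = -1) {γ δ : ℤ} (hm : Moves ε S D γ δ) :
    Set.ncard {j | γ < j ∧ j ∈ S} = Set.ncard {j | δ < j ∧ j ∈ T} := by
  have hs := h.strictMonoOn hε
  obtain ⟨h1, rfl⟩ := moves_iff.1 hm
  have : {j | stripMap ε D γ < j ∧ j ∈ T} = stripMap ε D '' {j | γ < j ∧ j ∈ S} := by
    ext δ
    simp only [← h.image_eq, Set.mem_ofPred_eq, Set.mem_image]
    constructor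
    · rintro ⟨h2, k, hk, rfl⟩
      exact ⟨k, ⟨(hs.lt_iff_lt h1 hk).1 h2, hk⟩, rfl⟩
    · rintro ⟨k, ⟨h2, hk⟩, rfl⟩
      exact ⟨hs h1 hk h2, k, hk, rfl⟩
  rw [this, (hs.injOn.mono fun _ h => h.2).ncard_image]

/-- The number of vacant sites beyond a particle and beyond its image differ by the displacement. -/
theorem ncard_compl_above_add (h : Strip ε S T D) (hε : ε = 1 ∨ ε = -1) {γ δ : ℤ}
    (hm : Moves ε S D γ δ) (hS : ∀ᶠ k in Filter.atTop, k ∈ S) (hT : ∀ᶠ k in Filter.atTop, k ∈ T) :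
    (Set.ncard {j | γ < j ∧ j ∉ S} : ℤ) + γ = Set.ncard {j | δ < j ∧ j ∉ T} + δ := by
  have hs := h.strictMonoOn hε
  obtain ⟨h1, rfl⟩ := moves_iff.1 hm
  have hD : ∀ᶠ k in Filter.atTop, k ∉ D := by
    obtain ⟨N, hN⟩ := h.finite.bddAbove
    filter_upwards [Filter.eventually_gt_atTop N] with k hk hkD
    exact absurd (hN hkD) (not_le.2 hk)
  -- `M` lies beyond both sites and beyond `D`, in the region where `S` and `T` are full. It is
  -- itself a particle at rest, so by monotonicity the cut at `M` is compatible with the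
  -- displacement.
  obtain ⟨M, hM⟩ := Filter.eventually_atTop.1 ((hS.and hT).and (hD.and
    ((Filter.eventually_gt_atTop γ).and (Filter.eventually_gt_atTop (stripMap ε D γ)))))
  have hMM : stripMap ε D M = M := if_neg (hM M le_rfl).2.1
  have e1 := ncard_compl_above (hM M le_rfl).2.2.1 fun k hk => (hM k hk).1.1
  have e2 := ncard_compl_above (hM M le_rfl).2.2.2 fun k hk => (hM k hk).1.2
  have : {j | stripMap ε D γ < j ∧ j < M ∧ j ∈ T} =
      stripMap ε D '' {j | γ < j ∧ j < M ∧ j ∈ S} := by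
    have hMS := (hM M le_rfl).1.1
    ext δ
    simp only [← h.image_eq, Set.mem_ofPred_eq, Set.mem_image]
    constructor
    · rintro ⟨h2, h3, k, hk, rfl⟩
      rw [← hMM, hs.lt_iff_lt hk hMS] at h3
      exact ⟨k, ⟨(hs.lt_iff_lt h1 hk).1 h2, h3, hk⟩, rfl⟩
    · rintro ⟨k, ⟨h2, h3, hk⟩, rfl⟩
      exact ⟨hs h1 hk h2, (hs hk hMS h3).trans_eq hMM, k, hk, rfl⟩
  rw [this, (hs.injOn.mono fun _ h => h.2.2).ncard_image] at e2
  omega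

/-- Removing a particle. -/
theorem remove (h : Strip ε S T D) (hε : ε = 1 ∨ ε = -1) {γ δ : ℤ} (hm : Moves ε S D γ δ) :
    Strip ε (S \ {γ}) (T \ {δ}) (D \ {γ}) where
  subset := Set.sdiff_subset_sdiff_left h.subset
  finite := h.finite.sdiff
  add_mem k hk hk' := ⟨h.add_mem k hk.1 hk'.1, hk'.2⟩
  mem_iff k := by
    have h0 := h.mem_iff k
    have h1 := h.add_mem (k - ε)
    rw [sub_add_cancel] at h1
    have h2 := h.add_mem γ
    obtain ⟨h3, ⟨rfl, h4⟩ | ⟨rfl, h4⟩⟩ := hm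
    · simp only [Set.mem_sdiff, Set.mem_singleton_iff]
      by_cases hk : k = δ
      · subst hk
        simp only [not_true, and_false, false_and, false_iff, not_or, not_and]
        exact ⟨fun h => h, fun h5 => absurd (h1 h5 h3) h4⟩
      · have : k - ε = δ → k - ε ∉ D := fun h => h ▸ h4
        tauto
    · simp only [Set.mem_sdiff, Set.mem_singleton_iff]
      have h5 := h2 h4
      by_cases hk : k = γ + ε
      · subst hk
        simp only [not_true, and_false, add_sub_cancel_right, or_false, false_iff]
        tauto
      · have hk' : k - ε ≠ γ := by omega
        simp only [hk, hk', not_false_iff, and_true, h0]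
        by_cases hkγ : k = γ
        · simp [hkγ, h4]
        · simp only [hkγ, not_false_iff, and_true]

/-- Adding a particle which stays in place. -/
theorem insert_stay (h : Strip ε S T D) {γ : ℤ} (hγ : γ ∉ S) (hδ : γ ∉ T) :
    Strip ε (insert γ S) (insert γ T) D where
  subset := h.subset.trans (Set.subset_insert _ _)
  finite := h.finite
  add_mem k hk hk' := by
    refine hk'.elim (fun h1 => ?_) (h.add_mem k hk)
    refine absurd ((h.mem_iff γ).2 (Or.inr ?_)) hδ
    rwa [← h1, add_sub_cancel_right]
  mem_iff k := by
    have h0 := h.mem_iff k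
    simp only [Set.mem_insert_iff]
    have : k = γ → k ∉ D := fun h1 h2 => hγ (h1 ▸ h.subset h2)
    tauto

/-- Adding a particle which moves. -/
theorem insert_step (h : Strip ε S T D) (hε : ε = 1 ∨ ε = -1) {γ : ℤ} (hγ : γ ∉ S)
    (hδ : γ + ε ∉ T) :
    Strip ε (insert γ S) (insert (γ + ε) T) (insert γ D) where
  subset := Set.insert_subset_insert h.subset
  finite := h.finite.insert γ
  add_mem k hk hk' := by
    refine hk'.elim Or.inl fun h1 => Or.inr ?_
    refine hk.elim (fun h2 => ?_) fun h2 => h.add_mem k h2 h1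
    subst h2
    by_contra h3
    exact hδ ((h.mem_iff _).2 (Or.inl ⟨h1, h3⟩))
  mem_iff k := by
    have h0 := h.mem_iff k
    simp only [Set.mem_insert_iff]
    have e : k = γ + ε ↔ k - ε = γ := by omega
    have : k = γ → k ∉ S := fun h1 => h1 ▸ hγ
    tauto

end Strip

/-- The possible end points of strips realizing the moves listed in `es` and having `d` further
displaced particles. -/
def ConstrainedStrip (ε : ℤ) (es : List (ℤ × ℤ)) (d : ℕ) (S T : Set ℤ) : Prop :=
  ∃ D, Strip ε S T D ∧ (∀ e ∈ es, Moves ε S D e.1 e.2) ∧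
    D.ncard = d + es.countP fun e => e.1 ≠ e.2

/-- A forced particle can be deleted together with its image, and conversely reinserted without
further condition: a conflict with the exclusion rule would require another particle to end at `δ`,
or the particle already at `δ` to stay there. A diagonal move leaves both `D` and the count of
listed diagonals, so `d` is unchanged. -/
theorem constrainedStrip_cons {ε : ℤ} (hε : ε = 1 ∨ ε = -1) {es : List (ℤ × ℤ)} {γ δ : ℤ}
    (he : δ = γ ∨ δ = γ + ε) (hes : (γ, δ) ∉ es) (d : ℕ) (S T : Set ℤ) :
    ConstrainedStrip ε ((γ, δ) :: es) d S T ↔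
      γ ∈ S ∧ δ ∈ T ∧ ConstrainedStrip ε es d (S \ {γ}) (T \ {δ}) := by
  have hε0 : ε ≠ 0 := by omega
  constructor
  · rintro ⟨D, h, h1, h2⟩
    have hm : Moves ε S D γ δ := h1 (γ, δ) List.mem_cons_self
    refine ⟨hm.1, (h.mem_iff_exists_moves δ).2 ⟨γ, hm⟩, D \ {γ}, h.remove hε hm, ?_, ?_⟩
    · rintro ⟨γ', δ'⟩ he'
      have hm' := h1 _ (List.mem_cons_of_mem _ he')
      -- A particle has a single destination, so a second listed move starting from `γ` would be the
      -- same pair.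
      have hne : γ' ≠ γ := by
        rintro rfl
        have := (moves_iff.1 hm).2.symm.trans (moves_iff.1 hm').2
        exact hes (this ▸ he')
      exact ⟨⟨hm'.1, hne⟩, hm'.2.imp (fun h => ⟨h.1, fun h' => h.2 h'.1⟩)
        fun h => ⟨h.1, h.2, hne⟩⟩
    · rw [List.countP_cons] at h2
      obtain ⟨-, ⟨rfl, h4⟩ | ⟨rfl, h4⟩⟩ := hm
      · rw [Set.sdiff_singleton_eq_self h4]
        simpa using h2
      · rw [Set.ncard_sdiff_singleton_of_mem h4]
        simp [hε0] at h2
        simp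
        omega
  · rintro ⟨hγ, hδ, D, h, h1, h2⟩
    have hγD : γ ∉ D := fun h' => (h.subset h').2 rfl
    rcases he with rfl | rfl
    · have hs := h.insert_stay (fun h => h.2 rfl) (fun h : δ ∈ T \ {δ} => h.2 rfl)
      rw [Set.insert_sdiff_singleton, Set.insert_sdiff_singleton, Set.insert_eq_of_mem hγ,
        Set.insert_eq_of_mem hδ] at hs
      refine ⟨D, hs, ?_, by rw [h2, List.countP_cons]; simp⟩
      rw [List.forall_mem_cons]
      exact ⟨⟨hγ, Or.inl ⟨rfl, hγD⟩⟩, fun e he => ⟨(h1 e he).1.1, (h1 e he).2⟩⟩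
    · have hs := h.insert_step hε (fun h => h.2 rfl) (fun h : γ + ε ∈ T \ {γ + ε} => h.2 rfl)
      rw [Set.insert_sdiff_singleton, Set.insert_sdiff_singleton, Set.insert_eq_of_mem hγ,
        Set.insert_eq_of_mem hδ] at hs
      refine ⟨insert γ D, hs, ?_, ?_⟩
      · rw [List.forall_mem_cons]
        refine ⟨⟨hγ, Or.inr ⟨rfl, Set.mem_insert _ _⟩⟩, fun e he => ?_⟩
        obtain ⟨h3, h4⟩ := h1 e he
        refine ⟨h3.1, h4.imp (fun h5 => ⟨h5.1, fun h6 => h6.elim (fun h7 => h3.2 h7) h5.2⟩)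
          fun h5 => ⟨h5.1, Or.inr h5.2⟩⟩
      · rw [Set.ncard_insert_of_notMem hγD h.finite, h2, List.countP_cons]
        simp [hε0]
        omega

/-! ### Reflecting and reversing strips -/

/-- The exchange of positive and negative half-integers. -/
def reflect (k : ℤ) : ℤ := -1 - k

theorem reflect_involutive : Function.Involutive reflect := fun k => by
  unfold reflect
  omega

theorem Strip.reflect {ε : ℤ} {S T D : Set ℤ} (h : Strip ε S T D) :
    Strip (-ε) (reflect ⁻¹' S) (reflect ⁻¹' T) (reflect ⁻¹' D) where
  subset := Set.preimage_mono h.subset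
  finite := h.finite.preimage reflect_involutive.injective.injOn
  add_mem k hk := by
    have : RailYard.reflect (k + -ε) = RailYard.reflect k + ε := by unfold RailYard.reflect; omega
    simp only [Set.mem_preimage, this]
    exact h.add_mem _ hk
  mem_iff k := by
    have : RailYard.reflect (k - -ε) = RailYard.reflect k - ε := by unfold RailYard.reflect; omega
    simp only [Set.mem_preimage, this]
    exact h.mem_iff _

theorem ncard_preimage_reflect (D : Set ℤ) : (reflect ⁻¹' D).ncard = D.ncard := by
  rw [← reflect_involutive.image_eq_preimage_symm,
    Set.ncard_image_of_injective _ reflect_involutive.injective]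

/-- Time reversal: the particles that have to move back are those that have just moved, now located
at `D + ε`. -/
theorem Strip.reverse {ε : ℤ} (hε : ε = 1 ∨ ε = -1) {S T D : Set ℤ} (h : Strip ε S T D) :
    Strip (-ε) T S ((· - ε) ⁻¹' D) where
  subset k hk := (h.mem_iff k).2 (Or.inr hk)
  finite := h.finite.preimage (sub_left_injective.injOn)
  add_mem k hk hk' := by
    have h1 := h.add_mem (k - ε - ε)
    simp only [Set.mem_preimage, ← sub_eq_add_neg, h.mem_iff, sub_add_cancel] at hk hk' h1 ⊢
    tauto
  mem_iff k := by
    have h1 := h.add_mem (k - ε)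
    have h2 := @h.subset k
    have h3 := @h.subset (k - ε)
    simp only [Set.mem_preimage, h.mem_iff k, sub_neg_eq_add, add_sub_cancel_right,
      sub_add_cancel] at h1 ⊢
    tauto

theorem ncard_preimage_sub (ε : ℤ) (D : Set ℤ) : ((· - ε) ⁻¹' D).ncard = D.ncard := by
  refine Set.ncard_preimage_of_injective_subset_range sub_left_injective fun k _ => ⟨k + ε, ?_⟩
  simp

/-- The existence of a strip with `d` displaced particles. -/
def StripRel (ε : ℤ) (d : ℕ) (S T : Set ℤ) : Prop :=
  ∃ D, Strip ε S T D ∧ D.ncard = d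

theorem stripRel_reflect (ε : ℤ) (d : ℕ) (S T : Set ℤ) :
    StripRel (-ε) d (reflect ⁻¹' S) (reflect ⁻¹' T) ↔ StripRel ε d S T := by
  constructor
  · rintro ⟨D, h, hd⟩
    refine ⟨_, ?_, (ncard_preimage_reflect D).trans hd⟩
    simpa only [neg_neg, ← Set.preimage_comp, reflect_involutive.comp_self, Set.preimage_id]
      using h.reflect
  · rintro ⟨D, h, hd⟩
    exact ⟨_, h.reflect, (ncard_preimage_reflect D).trans hd⟩

theorem stripRel_reverse {ε : ℤ} (hε : ε = 1 ∨ ε = -1) (d : ℕ) (S T : Set ℤ) :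
    StripRel (-ε) d T S ↔ StripRel ε d S T := by
  constructor
  · rintro ⟨D, h, hd⟩
    exact ⟨_, neg_neg ε ▸ h.reverse (by omega), (ncard_preimage_sub _ D).trans hd⟩
  · rintro ⟨D, h, hd⟩
    exact ⟨_, h.reverse hε, (ncard_preimage_sub _ D).trans hd⟩

/-! ### Strips between charged partitions -/

/-- An order-preserving bijection between two decreasingly enumerated sets matches equal indices, so
each particle is compared with the one of the same rank. In particular `D` is a function of `p` and
`q`. -/
theorem strip_range_iff {p q : ℕ → ℤ} (hp : StrictAnti p) (hq : StrictAnti q) (D : Set ℤ) :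
    Strip 1 (Set.range p) (Set.range q) D ↔
      D.Finite ∧ D = p '' {i | q i = p i + 1} ∧ ∀ i, q i = p i ∨ q i = p i + 1 := by
  constructor
  · intro h
    have hs := h.strictMonoOn (Or.inl rfl)
    have h1 : StrictAnti (stripMap 1 D ∘ p) := fun i j hij => hs ⟨_, rfl⟩ ⟨_, rfl⟩ (hp hij)
    have h2 : Set.range (stripMap 1 D ∘ p) = Set.range q := by
      rw [Set.range_comp, h.image_eq]
    have hn : (fun i => - (stripMap 1 D ∘ p) i) = fun i => - q i := by
      refine (StrictMono.range_inj (fun i j hij => neg_lt_neg (h1 hij))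
        (fun i j hij => neg_lt_neg (hq hij))).1 ?_
      have h3 := congrArg (fun s => (fun x : ℤ => -x) '' s) h2
      simpa only [← Set.range_comp, Function.comp_def] using h3
    have he : ∀ i, stripMap 1 D (p i) = q i := fun i => neg_injective (congrFun hn i)
    have hmem : ∀ i, p i ∈ D ↔ q i = p i + 1 := fun i => by
      rw [← he, stripMap]
      split_ifs with h <;> simp [h]
    refine ⟨h.finite, ?_, fun i => ?_⟩
    · ext k
      simp only [Set.mem_image, Set.mem_ofPred_eq, ← hmem]
      constructor
      · intro hk
        obtain ⟨i, rfl⟩ := h.subset hk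
        exact ⟨i, hk, rfl⟩
      · rintro ⟨i, hi, rfl⟩
        exact hi
    · rw [← he, stripMap]
      split_ifs <;> simp
  · rintro ⟨hD, rfl, h⟩
    have hmem : ∀ i, p i ∈ p '' {i | q i = p i + 1} ↔ q i = p i + 1 := fun i =>
      hp.injective.mem_set_image
    refine ⟨Set.image_subset_range _ _, hD, ?_, fun k => ?_⟩
    -- The particle `j` sits just above `i`, so its image must exceed `q i`, which is the old
    -- position of `j`; hence `j` moves too.
    · rintro - ⟨i, hi, rfl⟩ ⟨j, hj⟩
      refine ⟨j, ?_, hj⟩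
      have hji : j < i := by
        rw [← hp.lt_iff_gt, hj]
        omega
      have := hq hji
      simp only [Set.mem_ofPred_eq] at hi ⊢
      have := h j
      omega
    · constructor
      · rintro ⟨i, rfl⟩
        rcases h i with h1 | h1
        · left
          rw [h1, hmem, h1]
          exact ⟨⟨i, rfl⟩, by omega⟩
        · exact Or.inr ⟨i, h1, by omega⟩
      · rintro (⟨⟨i, rfl⟩, h1⟩ | ⟨i, h1, h2⟩)
        · rw [hmem] at h1
          exact ⟨i, (h i).resolve_right h1⟩
        · refine ⟨i, ?_⟩
          simp only [Set.mem_ofPred_eq] at h1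
          omega

theorem Strip.unique_range {p q : ℕ → ℤ} (hp : StrictAnti p) (hq : StrictAnti q) {D D' : Set ℤ}
    (h : Strip 1 (Set.range p) (Set.range q) D) (h' : Strip 1 (Set.range p) (Set.range q) D') :
    D = D' :=
  ((strip_range_iff hp hq D).1 h).2.1.trans ((strip_range_iff hp hq D').1 h').2.1.symm

theorem card_eq_sum_rowLen (μ : YoungDiagram) {n : ℕ}
    (hn : ∀ i, n ≤ i → μ.rowLen i = 0) : μ.card = ∑ i ∈ Finset.range n, μ.rowLen i := by
  have h : ∀ c ∈ μ.cells, c.1 ∈ Finset.range n := by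
    rintro ⟨i, j⟩ hc
    have := YoungDiagram.mem_iff_lt_rowLen.1 ((YoungDiagram.mem_cells _).1 hc)
    rw [Finset.mem_range]
    by_contra h
    have := hn i (not_lt.1 h)
    omega
  rw [YoungDiagram.card, Finset.card_eq_sum_card_fiberwise h]
  refine Finset.sum_congr rfl fun i _ => ?_
  rw [YoungDiagram.rowLen_eq_card]
  rfl

/-- The vertical strip condition expressed on rows, which are what the positions of black marbles
record. -/
theorem interlaced_transpose_iff (lam mu : YoungDiagram) :
    Interlaced lam.transpose mu.transpose ↔
      ∀ i, mu.rowLen i ≤ lam.rowLen i ∧ lam.rowLen i ≤ mu.rowLen i + 1 := by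
  have hl : ∀ i j, i < lam.colLen j ↔ j < lam.rowLen i := fun i j => by
    rw [← YoungDiagram.mem_iff_lt_colLen, ← YoungDiagram.mem_iff_lt_rowLen]
  have hm : ∀ i j, i < mu.colLen j ↔ j < mu.rowLen i := fun i j => by
    rw [← YoungDiagram.mem_iff_lt_colLen, ← YoungDiagram.mem_iff_lt_rowLen]
  simp only [Interlaced, YoungDiagram.rowLen_transpose]
  constructor
  · refine fun h i => ⟨le_of_forall_lt fun j hj => ?_, ?_⟩
    · rw [← hm] at hj
      rw [← hl]
      exact hj.trans_le (h j).1
    · by_contra! h1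
      have h2 := (hl i (mu.rowLen i + 1)).2 h1
      have h3 := (hm i (mu.rowLen i)).1 (h2.trans_le (h _).2)
      omega
  · refine fun h j => ⟨le_of_forall_lt fun i hi => ?_, le_of_forall_lt fun i hi => ?_⟩
    · rw [hm] at hi
      rw [hl]
      exact hi.trans_le (h i).1
    · rw [hl] at hi
      rw [hm]
      have := (h i).2
      omega

/-- Displacing the marble of rank `i` by `+1` at fixed charge adds one box to row `i`. The charge
cannot change because only finitely many marbles are displaced. -/
theorem stripRel_mayaOf_iff (p q : YoungDiagram × ℤ) (d : ℕ) :
    StripRel 1 d (mayaOf p).black (mayaOf q).black ↔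
      p.2 = q.2 ∧ Interlaced q.1.transpose p.1.transpose ∧ q.1.card = p.1.card + d := by
  have hp := blackPos_strictAnti p
  have hq := blackPos_strictAnti q
  obtain ⟨m, hm⟩ := exists_rowLen_eq_zero p.1
  obtain ⟨n, hn⟩ := exists_rowLen_eq_zero q.1
  have hp0 : ∀ i, max m n ≤ i → p.1.rowLen i = 0 := fun i hi => hm i (by omega)
  have hq0 : ∀ i, max m n ≤ i → q.1.rowLen i = 0 := fun i hi => hn i (by omega)
  have hcard : p.2 = q.2 → (∀ i, blackPos q i = blackPos p i ∨ blackPos q i = blackPos p i + 1) →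
      {i | blackPos q i = blackPos p i + 1}.Finite ∧
      q.1.card = p.1.card + (blackPos p '' {i | blackPos q i = blackPos p i + 1}).ncard := by
    intro hc h
    have hset : {i | blackPos q i = blackPos p i + 1} =
        ((Finset.range (max m n)).filter fun i => blackPos q i = blackPos p i + 1 : Finset ℕ) := by
      ext i
      simp only [Finset.coe_filter, Finset.mem_range, Set.mem_ofPred_eq, iff_and_self]
      intro h1
      by_contra h2
      have h3 := hp0 i (by omega)
      have h4 := hq0 i (by omega)
      unfold blackPos at h1
      omega
    refine ⟨hset ▸ Finset.finite_toSet _, ?_⟩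
    rw [Set.ncard_image_of_injective _ hp.injective, hset, Set.ncard_coe_finset,
      Finset.card_filter, card_eq_sum_rowLen _ hp0,
      card_eq_sum_rowLen _ hq0, ← Finset.sum_add_distrib]
    refine Finset.sum_congr rfl fun i _ => ?_
    have := h i
    unfold blackPos at this ⊢
    split_ifs <;> omega
  rw [interlaced_transpose_iff]
  change (∃ D, Strip 1 (Set.range (blackPos p)) (Set.range (blackPos q)) D ∧ D.ncard = d) ↔ _
  simp only [strip_range_iff hp hq]
  constructor
  · rintro ⟨D, ⟨h1, rfl, h3⟩, rfl⟩
    have hc : p.2 = q.2 := by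
      obtain ⟨N, hN⟩ := (h1.of_finite_image hp.injective.injOn).bddAbove
      -- At a rank beyond all displaced marbles and all nonzero rows, both positions depend only on
      -- the charge.
      have h4 : ¬ blackPos q (max (max m n) (N + 1)) = blackPos p (max (max m n) (N + 1)) + 1 :=
        fun h => by
          have := hN h
          omega
      have h5 := (h3 _).resolve_right h4
      unfold blackPos at h5
      rw [hp0 _ (by omega), hq0 _ (by omega)] at h5
      omega
    refine ⟨hc, fun i => ?_, (hcard hc h3).2⟩
    have := h3 i
    unfold blackPos at this
    omega
  · rintro ⟨hc, h1, h2⟩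
    have h3 : ∀ i, blackPos q i = blackPos p i ∨ blackPos q i = blackPos p i + 1 := fun i => by
      have := h1 i
      unfold blackPos
      omega
    have h4 := hcard hc h3
    exact ⟨_, ⟨h4.1.image _, rfl, h3⟩, by omega⟩

/-- Transposing a partition amounts to reflecting its Maya diagram and exchanging the colours. -/
theorem mayaOf_transpose_black (μ : YoungDiagram) (c : ℤ) :
    (mayaOf (μ.transpose, -c)).black = reflect ⁻¹' (mayaOf (μ, c)).blackᶜ := by
  have hl : ∀ i j, i < μ.colLen j ↔ j < μ.rowLen i := fun i j => by
    rw [← YoungDiagram.mem_iff_lt_colLen, ← YoungDiagram.mem_iff_lt_rowLen]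
  ext k
  simp only [mayaOf, Set.mem_range, Set.mem_preimage, Set.mem_compl_iff, blackPos, reflect,
    YoungDiagram.rowLen_transpose, not_exists]
  constructor
  · rintro ⟨j, rfl⟩ i h
    have := hl i j
    omega
  · intro h
    -- The least such `i` is the number of black marbles above the hole at `-1 - k`. The hole then
    -- corresponds to a column of length `i`, and solving for the position gives its index `i - c -
    -- 1 - k`.
    have hex : ∃ i : ℕ, (μ.rowLen i : ℤ) + c - i - 1 < -1 - k := by
      obtain ⟨n, hn⟩ := exists_rowLen_eq_zero μ
      refine ⟨max n (c + k + 1).toNat, ?_⟩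
      rw [hn _ (le_max_left _ _)]
      omega
    classical
    have h1 := Nat.find_spec hex
    have h2 : ∀ i < Nat.find hex, -1 - k < (μ.rowLen i : ℤ) + c - i - 1 := fun i hi => by
      have := Nat.find_min hex hi
      have := h i
      omega
    set i := Nat.find hex
    refine ⟨(i - c - 1 - k).toNat, ?_⟩
    have h3 : μ.colLen (i - c - 1 - k).toNat = i := by
      refine le_antisymm (not_lt.1 fun h4 => ?_) (not_lt.1 fun h4 => ?_)
      · have := (hl _ _).1 h4
        omega
      · have h5 := h2 (i - 1) (by omega)
        have h6 : ¬ i - 1 < μ.colLen (i - c - 1 - k).toNat := by omega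
        rw [hl] at h6
        omega
    rw [h3]
    omega

/-- The boundary states `l`, `r` of a column whose diagonal dimers start at the even vertices with
ordinates in `D`: for type `R` particles move from left to right, for type `L` holes move from right
to left. -/
def ColumnStrip (a : LR) (s : Sgn) (l r : Set ℤ) (D : Set ℤ) : Prop :=
  match a with
  | .R => Strip s.toInt l r D
  | .L => Strip s.toInt rᶜ lᶜ D

/-- The case `R`, `+` is `stripRel_mayaOf_iff`. Opposite signs are related by time reversal, and
type `L` is obtained by passing to holes: the holes of a diagram, reflected, are the black marbles
of the transposed partition with opposite charge. -/
theorem vertexRel_iff (a : LR) (s : Sgn) (d : ℕ) (p q : YoungDiagram × ℤ) :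
    (VertexRel a s d q.1 p.1 ∧ p.2 = q.2) ↔
      ∃ D, ColumnStrip a s (mayaOf p).black (mayaOf q).black D ∧ D.ncard = d := by
  have key : ∀ p q : YoungDiagram × ℤ,
      StripRel (-1) d (mayaOf p).blackᶜ (mayaOf q).blackᶜ ↔
        p.2 = q.2 ∧ Interlaced q.1 p.1 ∧ q.1.card = p.1.card + d := by
    intro p q
    have h := stripRel_mayaOf_iff (p.1.transpose, -p.2) (q.1.transpose, -q.2) d
    rw [mayaOf_transpose_black, mayaOf_transpose_black] at h
    have h2 := stripRel_reflect (-1) d (mayaOf p).blackᶜ (mayaOf q).blackᶜ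
    rw [neg_neg] at h2
    rw [← h2]
    refine h.trans ?_
    simp only [YoungDiagram.transpose_transpose, neg_inj]
    have hcard : ∀ μ : YoungDiagram, μ.transpose.card = μ.card := fun μ => by
      unfold YoungDiagram.card YoungDiagram.transpose
      simp
    rw [hcard, hcard]
  have rev := fun S T => stripRel_reverse (ε := 1) (Or.inl rfl) d S T
  cases a <;> cases s <;> simp only [ColumnStrip, VertexRel]
  · change _ ↔ StripRel 1 d _ _
    rw [← rev, key]
    tauto
  · change _ ↔ StripRel (-1) d _ _
    rw [key, eq_comm]
    tauto
  · change _ ↔ StripRel 1 d _ _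
    rw [stripRel_mayaOf_iff]
    tauto
  · change _ ↔ StripRel (-1) d _ _
    rw [rev, stripRel_mayaOf_iff, eq_comm]
    tauto

/-- Both diagrams have their black marbles enumerated decreasingly, so upward strips are covered by
`strip_range_iff`; downward ones become upward by time reversal. -/
theorem Strip.unique {s : Sgn} {l r : MayaDiagram} {D D' : Set ℤ}
    (h : Strip s.toInt l.black r.black D) (h' : Strip s.toInt l.black r.black D') : D = D' := by
  obtain ⟨p, rfl⟩ := mayaOf_surjective l
  obtain ⟨q, rfl⟩ := mayaOf_surjective r
  have hp := blackPos_strictAnti p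
  have hq := blackPos_strictAnti q
  cases s
  · exact h.unique_range hp hq h'
  · have h1 := Strip.unique_range hq hp (h.reverse (Or.inr rfl)) (h'.reverse (Or.inr rfl))
    exact (Set.preimage_injective.2 fun k => ⟨k + -1, by simp⟩) h1

/-- The Maya diagram obtained by reflection and colour exchange. -/
theorem exists_reflect_compl (m : MayaDiagram) :
    ∃ m' : MayaDiagram, m'.black = reflect ⁻¹' m.blackᶜ := by
  obtain ⟨⟨μ, c⟩, rfl⟩ := mayaOf_surjective m
  exact ⟨_, mayaOf_transpose_black μ c⟩

/-- This is why a covering is determined by its states. For type `L`, the holes become black marbles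
after reflection and exchange of colours. -/
theorem ColumnStrip.unique {a : LR} {s : Sgn} {l r : MayaDiagram} {D D' : Set ℤ}
    (h : ColumnStrip a s l.black r.black D) (h' : ColumnStrip a s l.black r.black D') : D = D' := by
  cases a
  · have h1 := Strip.reflect h
    have h2 := Strip.reflect h'
    obtain ⟨l', hl⟩ := exists_reflect_compl l
    obtain ⟨r', hr⟩ := exists_reflect_compl r
    rw [← hl, ← hr] at h1 h2
    have hs : ∃ s' : Sgn, s'.toInt = -s.toInt := by
      cases s
      · exact ⟨.minus, rfl⟩
      · exact ⟨.plus, rfl⟩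
    obtain ⟨s', hs'⟩ := hs
    rw [← hs'] at h1 h2
    exact (Set.preimage_injective.2 reflect_involutive.surjective) (h1.unique h2)
  · exact Strip.unique h h'

end RailYard

namespace RailYard

/-! ### Fermionic operators -/

theorem MayaDiagram.mem_flip (m : MayaDiagram) (j k : ℤ) :
    j ∈ (m.flip k).black ↔ (j ≠ k ∧ j ∈ m.black) ∨ (j = k ∧ j ∉ m.black) := Iff.rfl

theorem MayaDiagram.flip_flip (m : MayaDiagram) (k : ℤ) : (m.flip k).flip k = m := by
  ext j
  simp only [mem_flip]
  tauto

theorem MayaDiagram.flip_comm (m : MayaDiagram) (j k : ℤ) :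
    (m.flip j).flip k = (m.flip k).flip j := by
  ext i
  simp only [mem_flip]
  by_cases h1 : i = j <;> by_cases h2 : i = k <;> simp only [h1, h2] <;> tauto

theorem MayaDiagram.flip_eq_iff {m m' : MayaDiagram} {k : ℤ} : m.flip k = m' ↔ m = m'.flip k :=
  ⟨fun h => h ▸ (m.flip_flip k).symm, fun h => h ▸ m'.flip_flip k⟩

theorem MayaDiagram.flip_black_of_mem {m : MayaDiagram} {k : ℤ} (h : k ∈ m.black) :
    (m.flip k).black = m.black \ {k} := by
  ext j
  simp only [mem_flip, Set.mem_sdiff, Set.mem_singleton_iff]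
  have : j = k → j ∈ m.black := fun h' => h' ▸ h
  tauto

theorem MayaDiagram.flip_black_compl_of_notMem {m : MayaDiagram} {k : ℤ} (h : k ∉ m.black) :
    (m.flip k).blackᶜ = m.blackᶜ \ {k} := by
  ext j
  simp only [mem_flip, Set.mem_sdiff, Set.mem_singleton_iff, Set.mem_compl_iff]
  have : j = k → j ∉ m.black := fun h' => h' ▸ h
  tauto

theorem MayaDiagram.finite_above (m : MayaDiagram) (k : ℤ) : {j | k < j ∧ j ∈ m.black}.Finite := by
  obtain ⟨M, hM⟩ := Filter.eventually_atTop.1 m.eventually_white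
  refine (Set.finite_Ioo k M).subset fun j hj => ⟨hj.1, ?_⟩
  by_contra h
  exact hM j (not_lt.1 h) hj.2

variable {R : Type*} [CommRing R]

theorem fermiSign_flip_of_le {j k : ℤ} (h : k ≤ j) (m : MayaDiagram) :
    fermiSign R j (m.flip k) = fermiSign R j m := by
  unfold fermiSign
  congr 2
  ext i
  simp only [MayaDiagram.mem_flip, Set.mem_ofPred_eq]
  have : j < i → i ≠ k := fun h => by omega
  tauto

theorem fermiSign_flip_of_lt {j k : ℤ} (h : j < k) (m : MayaDiagram) :
    fermiSign R j (m.flip k) = -fermiSign R j m := by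
  have key : ∀ m : MayaDiagram, k ∉ m.black →
      fermiSign R j (m.flip k) = -fermiSign R j m := fun m hk => by
    unfold fermiSign
    have : {i | j < i ∧ i ∈ (m.flip k).black} = insert k {i | j < i ∧ i ∈ m.black} := by
      ext i
      simp only [MayaDiagram.mem_flip, Set.mem_ofPred_eq, Set.mem_insert_iff]
      by_cases hi : i = k
      · subst hi
        simp [h, hk]
      · simp [hi]
    rw [this, Set.ncard_insert_of_notMem (fun h => hk h.2) (m.finite_above j), pow_succ,
      mul_neg_one]
  by_cases hk : k ∈ m.black
  · have := key (m.flip k) (by simp [MayaDiagram.mem_flip, hk])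
    rw [MayaDiagram.flip_flip] at this
    rw [this, neg_neg]
  · exact key m hk

theorem fermiSign_mul_self (k : ℤ) (m : MayaDiagram) :
    fermiSign R k m * fermiSign R k m = 1 := by
  unfold fermiSign
  rw [← mul_pow]
  simp

section
open Classical

theorem psi_ket (k : ℤ) (m : MayaDiagram) : psi R k (ket R m) =
    if k ∉ m.black then fermiSign R k m • ket R (m.flip k) else 0 := by
  unfold psi ket
  rw [Finsupp.linearCombination_single, one_smul]

theorem psiStar_ket (k : ℤ) (m : MayaDiagram) : psiStar R k (ket R m) =
    if k ∈ m.black then fermiSign R k m • ket R (m.flip k) else 0 := by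
  unfold psiStar ket
  rw [Finsupp.linearCombination_single, one_smul]

theorem ket_apply (m l : MayaDiagram) : ket R m l = if m = l then 1 else 0 :=
  Finsupp.single_apply

/-- A statement about vectors which is linear holds if it holds for the basis vectors. -/
theorem fock_induction {P : Fock R → Prop} (v : Fock R) (h0 : P 0)
    (hadd : ∀ u v, P u → P v → P (u + v)) (hket : ∀ (c : R) m, P (c • ket R m)) : P v := by
  refine Finsupp.induction_linear v h0 hadd fun m c => ?_
  have := hket c m
  rwa [ket, Finsupp.smul_single, smul_eq_mul, mul_one] at this

/-- The transposed action, on bras: it evaluates the leftmost fermion of a product inside a matrix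
element. No sign is lost, since flipping site `k` does not affect the marbles beyond `k`. -/
theorem psi_apply (k : ℤ) (v : Fock R) (l : MayaDiagram) : psi R k v l =
    if k ∈ l.black then fermiSign R k l * v (l.flip k) else 0 := by
  induction v using fock_induction with
  | h0 => simp
  | hadd u v hu hv =>
    rw [map_add, Finsupp.add_apply, hu, hv, Finsupp.add_apply]
    split_ifs <;> ring
  | hket c m =>
    rw [map_smul, psi_ket, Finsupp.smul_apply, Finsupp.smul_apply, ket_apply]
    by_cases h : m = l.flip k
    · subst h
      simp only [MayaDiagram.mem_flip, MayaDiagram.flip_flip, fermiSign_flip_of_le le_rfl]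
      split_ifs <;> simp_all [ket_apply, mul_comm]
    · have h' : m.flip k ≠ l := fun h' => h (MayaDiagram.flip_eq_iff.1 h')
      split_ifs <;> simp [ket_apply, h']

theorem psiStar_apply (k : ℤ) (v : Fock R) (l : MayaDiagram) : psiStar R k v l =
    if k ∉ l.black then fermiSign R k l * v (l.flip k) else 0 := by
  induction v using fock_induction with
  | h0 => simp
  | hadd u v hu hv =>
    rw [map_add, Finsupp.add_apply, hu, hv, Finsupp.add_apply]
    split_ifs <;> ring
  | hket c m =>
    rw [map_smul, psiStar_ket, Finsupp.smul_apply, Finsupp.smul_apply, ket_apply]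
    by_cases h : m = l.flip k
    · subst h
      simp only [MayaDiagram.mem_flip, MayaDiagram.flip_flip, fermiSign_flip_of_le le_rfl]
      split_ifs <;> simp_all [ket_apply, mul_comm]
    · have h' : m.flip k ≠ l := fun h' => h (MayaDiagram.flip_eq_iff.1 h')
      split_ifs <;> simp [ket_apply, h']

/-- For `j < k`, flipping `k` changes the sign attached to `j`, whereas flipping `j` does not affect
the sign attached to `k`. For `j = k` both products vanish. -/
theorem psi_anticomm (j k : ℤ) : psi R j * psi R k = (-1 : R) • (psi R k * psi R j) := by
  have key : ∀ j k : ℤ, j < k → psi R j * psi R k = (-1 : R) • (psi R k * psi R j) :=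
    fun j k hjk => by
      refine LinearMap.ext fun v => Finsupp.ext fun l => ?_
      simp only [Module.End.mul_apply, LinearMap.smul_apply, Finsupp.smul_apply, psi_apply,
        MayaDiagram.mem_flip, fermiSign_flip_of_le hjk.le, fermiSign_flip_of_lt hjk,
        l.flip_comm j k]
      have h1 := hjk.ne
      have h2 := hjk.ne'
      by_cases hj : j ∈ l.black <;> by_cases hk : k ∈ l.black <;> simp [h1, h2, hj, hk]
      ring
  rcases lt_trichotomy j k with h | rfl | h
  · exact key j k h
  · have : psi R j * psi R j = 0 := by
      refine LinearMap.ext fun v => Finsupp.ext fun l => ?_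
      simp only [Module.End.mul_apply, psi_apply, MayaDiagram.mem_flip]
      by_cases hj : j ∈ l.black <;> simp [hj]
    rw [this, smul_zero]
  · rw [key k j h, smul_smul, neg_one_mul, neg_neg, one_smul]

theorem psiStar_anticomm (j k : ℤ) :
    psiStar R j * psiStar R k = (-1 : R) • (psiStar R k * psiStar R j) := by
  have key : ∀ j k : ℤ, j < k →
      psiStar R j * psiStar R k = (-1 : R) • (psiStar R k * psiStar R j) := fun j k hjk => by
    refine LinearMap.ext fun v => Finsupp.ext fun l => ?_
    simp only [Module.End.mul_apply, LinearMap.smul_apply, Finsupp.smul_apply, psiStar_apply,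
      MayaDiagram.mem_flip, fermiSign_flip_of_le hjk.le, fermiSign_flip_of_lt hjk,
      l.flip_comm j k]
    have h1 := hjk.ne
    have h2 := hjk.ne'
    by_cases hj : j ∈ l.black <;> by_cases hk : k ∈ l.black <;> simp [h1, h2, hj, hk]
    ring
  rcases lt_trichotomy j k with h | rfl | h
  · exact key j k h
  · have : psiStar R j * psiStar R j = 0 := by
      refine LinearMap.ext fun v => Finsupp.ext fun l => ?_
      simp only [Module.End.mul_apply, psiStar_apply, MayaDiagram.mem_flip]
      by_cases hj : j ∈ l.black <;> simp [hj]
    rw [this, smul_zero]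
  · rw [key k j h, smul_smul, neg_one_mul, neg_neg, one_smul]

/-! ### Conjugation by products of fermions -/

theorem mul_prod_of_anticomm {ι S : Type*} [Semiring S] [Algebra R S] {g : ι → S}
    (hg : ∀ i j, g i * g j = (-1 : R) • (g j * g i)) (i : ι) (es : List ι) :
    g i * (es.map g).prod = (-1 : R) ^ es.length • ((es.map g).prod * g i) := by
  induction es with
  | nil => simp
  | cons e es ih =>
    rw [List.map_cons, List.prod_cons, ← mul_assoc, hg, smul_mul_assoc, mul_assoc, ih,
      List.length_cons, pow_succ', mul_smul, mul_smul_comm, mul_assoc]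

variable (R) in
/-- The operator `A` between two products of fermions, with the sign reversing one of them. -/
def sandwich {ι S : Type*} [Semiring S] [Algebra R S] (f g : ι → S) (es : List ι) (A : S) : S :=
  (-1 : R) ^ (es.length * (es.length - 1) / 2) • ((es.map f).prod * A * (es.map g).prod)

theorem sandwich_nil {ι S : Type*} [Semiring S] [Algebra R S] (f g : ι → S) (A : S) :
    sandwich R f g [] A = A := by
  simp [sandwich]

/-- Moving `g e` to the far right past `es` costs `(-1) ^ es.length`, exactly the increment of the
triangular exponent. The products thus become nested pairs, ready for an induction on the list. -/
theorem sandwich_cons {ι S : Type*} [Semiring S] [Algebra R S] {f g : ι → S}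
    (hg : ∀ i j, g i * g j = (-1 : R) • (g j * g i)) (e : ι) (es : List ι) (A : S) :
    sandwich R f g (e :: es) A = f e * sandwich R f g es A * g e := by
  have h1 : ((-1) ^ es.length * (-1) ^ es.length : R) = 1 := by
    rw [← mul_pow]
    simp
  simp only [sandwich, List.map_cons, List.prod_cons, List.length_cons, Nat.triangle_succ, pow_add]
  rw [mul_prod_of_anticomm hg, mul_smul_comm, smul_smul, mul_assoc, h1, mul_one, mul_smul_comm,
    smul_mul_assoc]
  simp only [mul_assoc]

/-- All the matrix elements of `A` are `0` or `1`, the latter being those satisfying `P`. -/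
def IsIndicator (A : Module.End R (Fock R)) (P : MayaDiagram → MayaDiagram → Prop) : Prop :=
  ∀ l r, A (ket R r) l = if P l r then 1 else 0

theorem IsIndicator.congr {A : Module.End R (Fock R)} {P Q : MayaDiagram → MayaDiagram → Prop}
    (h : IsIndicator A P) (hPQ : ∀ l r, P l r ↔ Q l r) : IsIndicator A Q := fun l r => by
  rw [h]
  simp only [hPQ]

/-- Each outer pair `ψ_γ ⋯ ψ*_δ` removes `γ` from the left state and `δ` from the right one, which
is the recursion `constrainedStrip_cons`. Its two signs agree, hence multiply to `1`, because the
strip carries the particles beyond `γ` onto those beyond `δ`. -/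
theorem isIndicator_constrainedStrip_black {ε : ℤ} (hε : ε = 1 ∨ ε = -1)
    {A : Module.End R (Fock R)} {d : ℕ}
    (hA : IsIndicator A fun l r => StripRel ε d l.black r.black) (es : List (ℤ × ℤ))
    (hes : es.Nodup) (he : ∀ e ∈ es, e.2 = e.1 ∨ e.2 = e.1 + ε) :
    IsIndicator (sandwich R (fun e => psi R e.1) (fun e => psiStar R e.2) es A)
      fun l r => ConstrainedStrip ε es d l.black r.black := by
  induction es with
  | nil =>
    rw [sandwich_nil]
    refine hA.congr fun l r => ?_
    simp [ConstrainedStrip, StripRel]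
  | cons e es ih =>
    obtain ⟨γ, δ⟩ := e
    rw [List.nodup_cons] at hes
    rw [List.forall_mem_cons] at he
    dsimp only at he
    have ih := ih hes.2 he.2
    rw [sandwich_cons fun i j => psiStar_anticomm _ _]
    intro l r
    dsimp only
    have hiff := constrainedStrip_cons hε he.1 hes.1 d l.black r.black
    by_cases h : ConstrainedStrip ε ((γ, δ) :: es) d l.black r.black
    · have h' := hiff.1 h
      obtain ⟨D, hD, h1, -⟩ := id h
      have hn := hD.ncard_above hε (h1 _ List.mem_cons_self)
      have hs : fermiSign R γ l = fermiSign R δ r := by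
        unfold fermiSign
        rw [hn]
      rw [if_pos h, Module.End.mul_apply, Module.End.mul_apply, psi_apply, psiStar_ket,
        if_pos h'.1, if_pos h'.2.1, map_smul, Finsupp.smul_apply, ih, if_pos, hs, smul_eq_mul,
        mul_one, fermiSign_mul_self]
      dsimp only
      rw [MayaDiagram.flip_black_of_mem h'.1, MayaDiagram.flip_black_of_mem h'.2.1]
      exact h'.2.2
    · rw [if_neg h, Module.End.mul_apply, Module.End.mul_apply, psi_apply, psiStar_ket]
      split_ifs with h1 h2
      · rw [map_smul, Finsupp.smul_apply, ih, if_neg, smul_zero, mul_zero]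
        dsimp only
        rw [MayaDiagram.flip_black_of_mem h1, MayaDiagram.flip_black_of_mem h2]
        exact fun h3 => h (hiff.2 ⟨h1, h2, h3⟩)
      · simp
      · rfl

/-- The same recursion for holes, which go from the right state to the left one. The signs still
count black marbles, that is, sites vacant for the holes, and these counts differ by the
displacement: each diagonal edge costs a sign. -/
theorem isIndicator_constrainedStrip_white {ε : ℤ} (hε : ε = 1 ∨ ε = -1)
    {A : Module.End R (Fock R)} {d : ℕ}
    (hA : IsIndicator A fun l r => StripRel ε d r.blackᶜ l.blackᶜ) (es : List (ℤ × ℤ))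
    (hes : es.Nodup) (he : ∀ e ∈ es, e.2 = e.1 ∨ e.2 = e.1 + ε) :
    IsIndicator ((-1 : R) ^ (es.countP fun e => e.1 ≠ e.2) •
        sandwich R (fun e => psiStar R e.2) (fun e => psi R e.1) es A)
      fun l r => ConstrainedStrip ε es d r.blackᶜ l.blackᶜ := by
  induction es with
  | nil =>
    rw [sandwich_nil, List.countP_nil, pow_zero, one_smul]
    refine hA.congr fun l r => ?_
    simp [ConstrainedStrip, StripRel]
  | cons e es ih =>
    obtain ⟨α, β⟩ := e
    rw [List.nodup_cons] at hes
    rw [List.forall_mem_cons] at he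
    dsimp only at he
    have ih : ∀ l r, (-1) ^ (es.countP fun e => e.1 ≠ e.2) *
        sandwich R (fun e => psiStar R e.2) (fun e => psi R e.1) es A (ket R r) l =
          if ConstrainedStrip ε es d r.blackᶜ l.blackᶜ then 1 else 0 := fun l r => by
      rw [← ih hes.2 he.2 l r]
      rfl
    have ih' : ∀ l r, sandwich R (fun e => psiStar R e.2) (fun e => psi R e.1) es A (ket R r) l =
        (-1) ^ (es.countP fun e => e.1 ≠ e.2) *
          if ConstrainedStrip ε es d r.blackᶜ l.blackᶜ then 1 else 0 := fun l r => by
      rw [← ih, ← mul_assoc, ← mul_pow]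
      simp
    rw [sandwich_cons fun i j => psi_anticomm _ _]
    intro l r
    rw [LinearMap.smul_apply, Finsupp.smul_apply, smul_eq_mul]
    dsimp only
    have hiff := constrainedStrip_cons hε he.1 hes.1 d r.blackᶜ l.blackᶜ
    by_cases h : ConstrainedStrip ε ((α, β) :: es) d r.blackᶜ l.blackᶜ
    · have h' := hiff.1 h
      obtain ⟨D, hD, h1, -⟩ := id h
      have hn := hD.ncard_compl_above_add hε (h1 _ List.mem_cons_self) r.eventually_white
        l.eventually_white
      simp only [Set.mem_compl_iff, not_not] at hn
      -- By `hn` the two counts have the same parity if `α = β` and opposite parities if `β = α +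
      -- ε`.
      have hs : (-1) ^ (if α ≠ β then 1 else 0) * (fermiSign R β l * fermiSign R α r) = 1 := by
        unfold fermiSign
        rw [← pow_add, ← pow_add]
        refine Even.neg_one_pow ?_
        rw [Nat.even_iff]
        have := he.1
        split_ifs <;> omega
      rw [if_pos h, Module.End.mul_apply, Module.End.mul_apply, psiStar_apply, psi_ket,
        if_pos (Set.notMem_of_mem_compl h'.1), if_pos (Set.notMem_of_mem_compl h'.2.1), map_smul,
        Finsupp.smul_apply, ih', if_pos, smul_eq_mul,
        mul_one, List.countP_cons, pow_add]
      · simp only [decide_eq_true_eq]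
        have hc : ((-1) ^ (es.countP fun e => decide (e.1 ≠ e.2)) *
            (-1) ^ (es.countP fun e => decide (e.1 ≠ e.2)) : R) = 1 := by
          rw [← mul_pow]
          simp
        linear_combination hs + (-1) ^ (if α ≠ β then 1 else 0) *
          (fermiSign R β l * fermiSign R α r) * hc
      · rw [MayaDiagram.flip_black_compl_of_notMem h'.1,
          MayaDiagram.flip_black_compl_of_notMem h'.2.1]
        exact h'.2.2
    · rw [if_neg h, Module.End.mul_apply, Module.End.mul_apply, psiStar_apply, psi_ket]
      split_ifs with h1 h2
      · simp
      · simp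
      · rw [map_smul, Finsupp.smul_apply, ih', if_neg, mul_zero, smul_zero, mul_zero, mul_zero]
        rw [MayaDiagram.flip_black_compl_of_notMem h1, MayaDiagram.flip_black_compl_of_notMem h2]
        exact fun h3 => h (hiff.2 ⟨h2, h1, h3⟩)

/-! ### Fermion pairs as tests of the colour of a site -/

theorem stripRel_zero_iff (ε : ℤ) (S T : Set ℤ) : StripRel ε 0 S T ↔ S = T := by
  constructor
  · rintro ⟨D, h, hD⟩
    rw [Set.ncard_eq_zero h.finite] at hD
    subst hD
    ext k
    simp [h.mem_iff]
  · rintro rfl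
    exact ⟨∅, ⟨Set.empty_subset _, Set.finite_empty, by simp, by simp⟩, by simp⟩

/-- Horizontal edges and no further displacement force `D = ∅`. This lets the two sandwich lemmas,
applied to the identity, describe the side of a column without diagonals. -/
theorem constrainedStrip_zero_iff (ε : ℤ) {es : List (ℤ × ℤ)} (he : ∀ e ∈ es, e.2 = e.1)
    (S T : Set ℤ) : ConstrainedStrip ε es 0 S T ↔ S = T ∧ ∀ e ∈ es, e.1 ∈ S := by
  have hc : (es.countP fun e => e.1 ≠ e.2) = 0 := by
    rw [List.countP_eq_zero]
    intro e h
    simp [he e h]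
  rw [← stripRel_zero_iff ε]
  constructor
  · rintro ⟨D, h, h1, h2⟩
    exact ⟨⟨D, h, h2.trans (by rw [hc])⟩, fun e h => (h1 e h).1⟩
  · rintro ⟨⟨D, h, hD⟩, h1⟩
    refine ⟨D, h, fun e he' => ⟨h1 e he', Or.inl ⟨he e he', ?_⟩⟩, by rw [hc, hD]⟩
    rw [Set.ncard_eq_zero h.finite] at hD
    simp [hD]

theorem isIndicator_one : IsIndicator (1 : Module.End R (Fock R)) fun l r => r = l := fun l r =>
  ket_apply r l

/-- A product of pairs `ψ_k ψ*_k` tests the presence of particles. -/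
theorem isIndicator_sandwich_black (es : List (ℤ × ℤ)) (hes : es.Nodup)
    (he : ∀ e ∈ es, e.2 = e.1) :
    IsIndicator (sandwich R (fun e => psi R e.1) (fun e => psiStar R e.2) es 1)
      fun l r => l = r ∧ ∀ e ∈ es, e.1 ∈ r.black := by
  refine (isIndicator_constrainedStrip_black (ε := 1) (d := 0) (Or.inl rfl)
    (isIndicator_one.congr fun l r => ?_) es hes fun e h => Or.inl (he e h)).congr fun l r => ?_
  · rw [stripRel_zero_iff, eq_comm, MayaDiagram.ext_iff]
  · rw [constrainedStrip_zero_iff _ he, MayaDiagram.ext_iff]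
    exact and_congr_right fun h => by rw [h]

/-- A product of pairs `ψ*_k ψ_k` tests the absence of particles. -/
theorem isIndicator_sandwich_white (es : List (ℤ × ℤ)) (hes : es.Nodup)
    (he : ∀ e ∈ es, e.2 = e.1) :
    IsIndicator (sandwich R (fun e => psiStar R e.2) (fun e => psi R e.1) es 1)
      fun l r => l = r ∧ ∀ e ∈ es, e.1 ∉ l.black := by
  have hc : (es.countP fun e => e.1 ≠ e.2) = 0 := by
    rw [List.countP_eq_zero]
    intro e h
    simp [he e h]
  have h := isIndicator_constrainedStrip_white (R := R) (ε := 1) (d := 0) (Or.inl rfl)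
    (isIndicator_one.congr fun l r => ?_) es hes fun e h => Or.inl (he e h)
  · rw [hc, pow_zero, one_smul] at h
    refine h.congr fun l r => ?_
    rw [constrainedStrip_zero_iff _ he, MayaDiagram.ext_iff, compl_inj_iff, eq_comm]
    exact and_congr_right fun h => by simp [h]
  · rw [stripRel_zero_iff, compl_inj_iff, MayaDiagram.ext_iff]

/-- `A` is a diagonal projection, so multiplying by it only restricts the left state. -/
theorem IsIndicator.mul_of_left {A B : Module.End R (Fock R)} {Q : MayaDiagram → Prop}
    {P : MayaDiagram → MayaDiagram → Prop} (hA : IsIndicator A fun l r => l = r ∧ Q l)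
    (hB : IsIndicator B P) : IsIndicator (A * B) fun l r => Q l ∧ P l r := by
  have h : ∀ (v : Fock R) l, A v l = if Q l then v l else 0 := fun v l => by
    induction v using fock_induction with
    | h0 => simp
    | hadd u v hu hv =>
      rw [map_add, Finsupp.add_apply, hu, hv, Finsupp.add_apply]
      split_ifs <;> simp
    | hket c m =>
      rw [map_smul, Finsupp.smul_apply, hA, Finsupp.smul_apply, ket_apply]
      by_cases h1 : Q l <;> by_cases h2 : l = m <;> simp [h1, h2, eq_comm]
  intro l r
  dsimp only
  rw [Module.End.mul_apply, h, hB]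
  by_cases h1 : Q l <;> simp [h1]

theorem IsIndicator.mul_of_right {A B : Module.End R (Fock R)} {Q : MayaDiagram → Prop}
    {P : MayaDiagram → MayaDiagram → Prop} (hA : IsIndicator A P)
    (hB : IsIndicator B fun l r => l = r ∧ Q r) : IsIndicator (A * B) fun l r => P l r ∧ Q r := by
  intro l r
  have h : B (ket R r) = if Q r then ket R r else 0 := by
    ext m
    rw [hB]
    by_cases h1 : Q r <;> by_cases h2 : m = r <;> simp [h1, h2, ket_apply]
    exact fun h3 => absurd h3.symm h2
  rw [Module.End.mul_apply, h]
  split_ifs with h1 h2 h2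
  · rw [hA, if_pos h2.1]
  · rw [hA, if_neg fun h => h2 ⟨h, h1⟩]
  · exact absurd h2.2 h1
  · simp

/-! ### Matrix elements of the vertex operators -/

theorem isIndicator_vertexCoeff (a : LR) (s : Sgn) (d : ℕ) :
    IsIndicator (vertexCoeff R a s d)
      fun l r => ∃ D, ColumnStrip a s l.black r.black D ∧ D.ncard = d := by
  intro l r
  obtain ⟨p, rfl⟩ := chargedEquiv.surjective l
  obtain ⟨q, rfl⟩ := chargedEquiv.surjective r
  have h := vertexRel_iff a s d p q
  change _ ↔ ∃ D, ColumnStrip a s (chargedEquiv p).black (chargedEquiv q).black D ∧ D.ncard = d at h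
  refine Eq.trans ?_ (if_congr h rfl rfl)
  unfold vertexCoeff
  rw [ket, Finsupp.linearCombination_single, one_smul, Finsupp.finsetSum_apply]
  simp only [Equiv.symm_apply_apply, ket_apply, EmbeddingLike.apply_eq_iff_eq, Prod.ext_iff]
  by_cases hc : q.2 = p.2
  · simp [hc]
  · simp [hc, Ne.symm hc]

end

end RailYard

namespace RailYard

variable {R : Type*} [CommRing R]

/-! ### Matrix elements of the constrained transfer matrices -/

theorem neg_one_mul_formalOp (F : FormalOp R) : (-1) * F = (-1 : R) • F := by
  have key : ∀ (S : Type _) [Ring S] (x : S), -1 * x = -x := fun S _ x => neg_one_mul x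
  have h : (-1 : FormalOp R) * F = -F := key (FormalOp R) F
  rw [h]
  ext n v l
  change -(MvPowerSeries.coeff n F (ket R v)) l = _
  simp [ket]

theorem neg_one_pow_mul_formalOp (F : FormalOp R) (k : ℕ) : (-1) ^ k * F = (-1 : R) ^ k • F := by
  induction k generalizing F with
  | zero => simp
  | succ k ih => rw [pow_succ, mul_assoc, ih, neg_one_mul_formalOp, smul_smul, pow_succ]

theorem coeff_smul_formalOp (n : ℤ →₀ ℕ) (c : R) (F : FormalOp R) :
    MvPowerSeries.coeff n (c • F) = c • MvPowerSeries.coeff n F := rfl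

/-- The ordinates of the end points of edges. -/
def heights (es : List (Vertex × Vertex)) : List (ℤ × ℤ) :=
  es.map fun e => (e.1.2, e.2.2)

theorem psiProd_eq (es : List (Vertex × Vertex)) :
    psiProd R es = MvPowerSeries.C (((heights es).map fun e => psi R e.1).prod) := by
  rw [psiProd, heights, map_list_prod, List.map_map, List.map_map]
  rfl

theorem psiStarProd_eq (es : List (Vertex × Vertex)) :
    psiStarProd R es = MvPowerSeries.C (((heights es).map fun e => psiStar R e.2).prod) := by
  rw [psiStarProd, heights, map_list_prod, List.map_map, List.map_map]
  rfl

/-- The edges to the left (`As`) and to the right (`Ds`) of a column are those of a covering. -/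
def ColumnContains (a : LR) (s : Sgn) (As Ds : List (ℤ × ℤ)) (l r D : Set ℤ) : Prop :=
  match a with
  | .R => (∀ e ∈ As, e.1 ∉ l) ∧ ∀ e ∈ Ds, Moves s.toInt l D e.1 e.2
  | .L => (∀ e ∈ As, Moves s.toInt rᶜ D e.1 e.2) ∧ ∀ e ∈ Ds, e.1 ∈ r

/-- The lists `As` and `Ds` consist of distinct edges to the left and to the right of a column, and
`n` of them are diagonal. -/
def ColumnEdges (a : LR) (s : Sgn) (As Ds : List (ℤ × ℤ)) (n : ℕ) : Prop :=
  As.Nodup ∧ Ds.Nodup ∧ match a with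
  | .R => (∀ e ∈ As, e.2 = e.1) ∧ (∀ e ∈ Ds, e.2 = e.1 ∨ e.2 = e.1 + s.toInt) ∧
      Ds.countP (fun e => e.1 ≠ e.2) = n
  | .L => (∀ e ∈ As, e.2 = e.1 ∨ e.2 = e.1 + s.toInt) ∧ (∀ e ∈ Ds, e.2 = e.1) ∧
      As.countP (fun e => e.1 ≠ e.2) = n

variable {a : ℤ → LR} {b : ℤ → Sgn}

/-- The coefficient of `x_i ^ (n + d)` in the constrained transfer matrix `T_i`. -/
noncomputable def transferCoeff (R : Type*) [CommRing R] (a : LR) (s : Sgn) (As Ds : List (ℤ × ℤ))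
    (n d : ℕ) : Module.End R (Fock R) :=
  match a with
  | .R => sandwich R (fun e => psiStar R e.2) (fun e => psi R e.1) As 1 *
      sandwich R (fun e => psi R e.1) (fun e => psiStar R e.2) Ds (vertexCoeff R .R s d)
  | .L => (-1 : R) ^ n •
      sandwich R (fun e => psiStar R e.2) (fun e => psi R e.1) As (vertexCoeff R .L s d) *
      sandwich R (fun e => psi R e.1) (fun e => psiStar R e.2) Ds 1

/-- The edges on the side of the diagonals surround the vertex operator and constrain the strip;
those on the other side form a diagonal projection. The `d` displacements seen by the vertex
operator are the unforced ones, whence the total `d + n`. -/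
theorem isIndicator_transferCoeff {a : LR} {s : Sgn} {As Ds : List (ℤ × ℤ)} {n : ℕ}
    (h : ColumnEdges a s As Ds n) (d : ℕ) :
    IsIndicator (transferCoeff R a s As Ds n d) fun l r => ∃ D,
      ColumnStrip a s l.black r.black D ∧ ColumnContains a s As Ds l.black r.black D ∧
        D.ncard = d + n := by
  obtain ⟨hA, hD, h⟩ := h
  cases a
  · obtain ⟨hA', hD', rfl⟩ := h
    refine ((isIndicator_constrainedStrip_white s.toInt_eq (isIndicator_vertexCoeff .L s d) As hA
      hA').mul_of_right (isIndicator_sandwich_black Ds hD hD')).congr fun l r => ?_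
    constructor
    · rintro ⟨⟨D, h1, h2, h3⟩, h4⟩
      exact ⟨D, h1, ⟨h2, h4⟩, h3⟩
    · rintro ⟨D, h1, ⟨h2, h4⟩, h3⟩
      exact ⟨⟨D, h1, h2, h3⟩, h4⟩
  · obtain ⟨hA', hD', rfl⟩ := h
    refine ((isIndicator_sandwich_white As hA hA').mul_of_left
      (isIndicator_constrainedStrip_black s.toInt_eq (isIndicator_vertexCoeff .R s d) Ds hD
      hD')).congr fun l r => ?_
    constructor
    · rintro ⟨h4, ⟨D, h1, h2, h3⟩⟩
      exact ⟨D, h1, ⟨h4, h2⟩, h3⟩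
    · rintro ⟨D, h1, ⟨h4, h2⟩, h3⟩
      exact ⟨h4, D, h1, h2, h3⟩

open Classical in
-- Fermions are constant series and the vertex operator involves only the variable `x_i`, so only
-- powers of `x_i` divisible by `x_i ^ n_i` survive.
theorem coeff_transfer (E : Finset (Sym2 Vertex)) (A D : ℤ → List (Vertex × Vertex)) (i : ℤ)
    (n : ℤ →₀ ℕ) :
    MvPowerSeries.coeff n (transfer R a b E A D i) =
      if n = Finsupp.single i (n i) ∧ numDiag a b E i ≤ n i then
        transferCoeff R (a i) (b i) (heights (A i)) (heights (D i)) (numDiag a b E i)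
          (n i - numDiag a b E i)
      else 0 := by
  have hΓ : ∀ (c : LR) (k : ℕ),
      (if Finsupp.single i k ≤ n then
        MvPowerSeries.coeff (n - Finsupp.single i k) (vertexOp R c (b i) i) else 0) =
      if n = Finsupp.single i (n i) ∧ k ≤ n i then vertexCoeff R c (b i) (n i - k) else 0 := by
    intro c k
    by_cases hk : k ≤ n i
    · rw [if_pos (Finsupp.single_le_iff.2 hk)]
      change (if n - Finsupp.single i k = Finsupp.single i ((n - Finsupp.single i k) i) then
        vertexCoeff R c (b i) ((n - Finsupp.single i k) i) else 0) = _
      have h1 : (n - Finsupp.single i k) i = n i - k := by simp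
      rw [h1]
      have h2 : n - Finsupp.single i k = Finsupp.single i (n i - k) ↔
          n = Finsupp.single i (n i) := by
        rw [tsub_eq_iff_eq_add_of_le (Finsupp.single_le_iff.2 hk), ← Finsupp.single_add,
          Nat.sub_add_cancel hk]
      simp only [h2, hk, and_true]
    · rw [if_neg fun h => hk (Finsupp.single_le_iff.1 h), if_neg fun h => hk h.2]
  have hl : ∀ es : List (Vertex × Vertex), (heights es).length = es.length := fun es => by
    simp [heights]
  unfold transfer transferCoeff
  cases ha : a i <;> dsimp only
  all_goals
    simp only [mul_assoc]
    rw [neg_one_pow_mul_formalOp, coeff_smul_formalOp, MvPowerSeries.X_pow_eq,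
      MvPowerSeries.coeff_monomial_mul]
    simp only [psiProd_eq, psiStarProd_eq, ← map_mul MvPowerSeries.C, MvPowerSeries.coeff_C_mul,
      MvPowerSeries.coeff_mul_C, one_mul]
    by_cases hk : numDiag a b E i ≤ n i
    · rw [if_pos (Finsupp.single_le_iff.2 hk)]
      have h := hΓ (a i) (numDiag a b E i)
      rw [if_pos (Finsupp.single_le_iff.2 hk), ha] at h
      rw [h]
      by_cases h1 : n = Finsupp.single i (n i) ∧ numDiag a b E i ≤ n i
      · rw [if_pos h1, if_pos h1]
        simp only [sandwich, hl, pow_add, smul_smul, smul_mul_assoc, mul_smul_comm, mul_one,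
          mul_assoc]
        congr 1
        ring
      · rw [if_neg h1, if_neg h1]
        simp
    · rw [if_neg fun h => hk (Finsupp.single_le_iff.1 h), if_neg fun h => hk h.2, smul_zero]

/-- The number of diagonal dimers in a column with given boundary states. -/
noncomputable def stripWeight (a : LR) (s : Sgn) (l r : MayaDiagram) : ℕ :=
  open Classical in
  if h : ∃ D, ColumnStrip a s l.black r.black D then h.choose.ncard else 0

theorem ColumnStrip.ncard_eq {a : LR} {s : Sgn} {l r : MayaDiagram} {D : Set ℤ}
    (h : ColumnStrip a s l.black r.black D) : D.ncard = stripWeight a s l r := by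
  have hex : ∃ D, ColumnStrip a s l.black r.black D := ⟨D, h⟩
  rw [stripWeight, dif_pos hex, h.unique hex.choose_spec]

/-- The pairs of boundary states of the coverings of a column which contain given edges. -/
def ColumnRel (a : LR) (s : Sgn) (As Ds : List (ℤ × ℤ)) (l r : MayaDiagram) : Prop :=
  ∃ D, ColumnStrip a s l.black r.black D ∧ ColumnContains a s As Ds l.black r.black D

/-- Forced diagonals have distinct even endpoints, all in `D`. This makes the natural subtraction `n
i - numDiag a b E i` exact. -/
theorem ColumnContains.le_ncard {a : LR} {s : Sgn} {As Ds : List (ℤ × ℤ)} {n : ℕ}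
    (h : ColumnEdges a s As Ds n) {l r D : Set ℤ} (hD : D.Finite)
    (hc : ColumnContains a s As Ds l r D) : n ≤ D.ncard := by
  have key : ∀ (es : List (ℤ × ℤ)) (S : Set ℤ), es.Nodup →
      (∀ e ∈ es, Moves s.toInt S D e.1 e.2) → (es.countP fun e => e.1 ≠ e.2) ≤ D.ncard := by
    intro es S hes hm
    have hne : ∀ e ∈ es, e.1 ≠ e.2 → e.2 = e.1 + s.toInt ∧ e.1 ∈ D := fun e he hne =>
      (hm e he).2.resolve_left fun h => hne h.1.symm
    rw [List.countP_eq_length_filter, ← List.toFinset_card_of_nodup (hes.filter _),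
      ← Set.ncard_coe_finset]
    refine Set.ncard_le_ncard_of_injOn Prod.fst ?_ ?_ hD
    · intro e he
      simp only [ne_eq, decide_not, List.coe_toFinset, List.mem_filter, Bool.not_eq_eq_eq_not,
        Bool.not_true, decide_eq_false_iff_not, Set.mem_ofPred_eq] at he
      exact (hne e he.1 he.2).2
    · intro e he e' he' hee
      simp only [ne_eq, decide_not, List.coe_toFinset, List.mem_filter, Bool.not_eq_eq_eq_not,
        Bool.not_true, decide_eq_false_iff_not, Set.mem_ofPred_eq] at he he'
      refine Prod.ext hee ?_
      rw [(hne e he.1 he.2).1, (hne e' he'.1 he'.2).1, hee]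
  obtain ⟨hA, hDs, h⟩ := h
  cases a
  · obtain ⟨-, -, rfl⟩ := h
    exact key As _ hA hc.1
  · obtain ⟨-, -, rfl⟩ := h
    exact key Ds _ hDs hc.2

theorem ColumnStrip.finite {a : LR} {s : Sgn} {l r D : Set ℤ} (h : ColumnStrip a s l r D) :
    D.Finite := by
  cases a
  · exact Strip.finite h
  · exact Strip.finite h

open Classical in
-- Since two states are joined by at most one strip, the degree is a function of the states: each
-- matrix element of `T_i` is `0` or a single monomial with coefficient `1`.
theorem coeff_transfer_apply {E : Finset (Sym2 Vertex)} {A D : ℤ → List (Vertex × Vertex)} {i : ℤ}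
    (h : ColumnEdges (a i) (b i) (heights (A i)) (heights (D i)) (numDiag a b E i))
    (n : ℤ →₀ ℕ) (l r : MayaDiagram) :
    MvPowerSeries.coeff n (transfer R a b E A D i) (ket R r) l =
      if ColumnRel (a i) (b i) (heights (A i)) (heights (D i)) l r ∧
        n = Finsupp.single i (stripWeight (a i) (b i) l r) then 1 else 0 := by
  have hiff : (ColumnRel (a i) (b i) (heights (A i)) (heights (D i)) l r ∧
        n = Finsupp.single i (stripWeight (a i) (b i) l r)) ↔
      (n = Finsupp.single i (n i) ∧ numDiag a b E i ≤ n i) ∧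
        ∃ Dg, ColumnStrip (a i) (b i) l.black r.black Dg ∧
          ColumnContains (a i) (b i) (heights (A i)) (heights (D i)) l.black r.black Dg ∧
          Dg.ncard = (n i - numDiag a b E i) + numDiag a b E i := by
    constructor
    · rintro ⟨⟨Dg, h1, h2⟩, h3⟩
      have h4 := h1.ncard_eq
      have h5 := h2.le_ncard h h1.finite
      have h6 : n i = Dg.ncard := by
        rw [h3, h4]
        simp
      rw [h6]
      exact ⟨⟨h4 ▸ h3, h5⟩, Dg, h1, h2, by omega⟩
    · rintro ⟨⟨h1, h2⟩, Dg, h3, h4, h5⟩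
      refine ⟨⟨Dg, h3, h4⟩, ?_⟩
      rw [← h3.ncard_eq, h5, Nat.sub_add_cancel h2]
      exact h1
  rw [if_congr hiff rfl rfl, coeff_transfer]
  by_cases h1 : n = Finsupp.single i (n i) ∧ numDiag a b E i ≤ n i
  · rw [if_pos h1, isIndicator_transferCoeff h]
    exact if_congr (and_iff_right h1).symm rfl rfl
  · rw [if_neg h1, if_neg fun h => h1 h.1]
    rfl

end RailYard

namespace RailYard

variable {R : Type*} [CommRing R]

/-! ### Products of operators whose matrix elements are monomials -/

section Chain

variable {X M : Type*} [AddCommMonoid M]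

/-- Sequences of states, consecutive ones being related. -/
def IsStateChain (rel : ℕ → X → X → Prop) {k : ℕ} (s : Fin (k + 1) → X) : Prop :=
  ∀ j : Fin k, rel j (s j.castSucc) (s j.succ)

/-- The sum of the weights of the steps of a sequence. -/
def chainWeight (wt : ℕ → X → X → M) {k : ℕ} (s : Fin (k + 1) → X) : M :=
  ∑ j : Fin k, wt j (s j.castSucc) (s j.succ)

theorem isStateChain_snoc (rel : ℕ → X → X → Prop) {k : ℕ} (s : Fin (k + 1) → X) (x : X) :
    IsStateChain rel (Fin.snoc s x : Fin (k + 2) → X) ↔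
      IsStateChain rel s ∧ rel k (s (Fin.last k)) x := by
  unfold IsStateChain
  rw [Fin.forall_fin_succ']
  refine and_congr (forall_congr' fun j => ?_) ?_
  · rw [Fin.snoc_castSucc, ← Fin.castSucc_succ, Fin.snoc_castSucc]
    rfl
  · rw [Fin.snoc_castSucc, Fin.succ_last, Fin.snoc_last]
    rfl

theorem chainWeight_snoc (wt : ℕ → X → X → M) {k : ℕ} (s : Fin (k + 1) → X) (x : X) :
    chainWeight wt (Fin.snoc s x : Fin (k + 2) → X) =
      chainWeight wt s + wt k (s (Fin.last k)) x := by
  unfold chainWeight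
  rw [Fin.sum_univ_castSucc]
  congr 1
  · refine Finset.sum_congr rfl fun j _ => ?_
    rw [Fin.snoc_castSucc, ← Fin.castSucc_succ, Fin.snoc_castSucc]
    rfl
  · rw [Fin.snoc_castSucc, Fin.succ_last, Fin.snoc_last]
    rfl

end Chain

open Classical in
/-- The matrix elements of a product of operators with monomial matrix elements. -/
theorem exists_coeff_prod_eq_sum [Nontrivial R] {T : ℕ → FormalOp R}
    {rel : ℕ → MayaDiagram → MayaDiagram → Prop}
    {wt : ℕ → MayaDiagram → MayaDiagram → (ℤ →₀ ℕ)} {K : ℕ}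
    (hT : ∀ j < K, ∀ n l r, MvPowerSeries.coeff n (T j) (ket R r) l =
      if rel j l r ∧ n = wt j l r then 1 else 0) (k : ℕ) (hk : k ≤ K) (r : MayaDiagram)
    (n : ℤ →₀ ℕ) :
    ∃ F : Finset (Fin (k + 1) → MayaDiagram),
      (∀ s, s ∈ F ↔ IsStateChain rel s ∧ s (Fin.last k) = r ∧ chainWeight wt s = n) ∧
      MvPowerSeries.coeff n ((List.range k).map T).prod (ket R r) = ∑ s ∈ F, ket R (s 0) := by
  induction k generalizing r n with
  | zero =>
    by_cases hn : n = 0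
    · subst hn
      refine ⟨{fun _ => r}, fun s => ?_, ?_⟩
      · simp only [Finset.mem_singleton, IsStateChain, chainWeight, Finset.univ_eq_empty,
          Finset.sum_empty, IsEmpty.forall_iff, true_and, and_true]
        constructor
        · rintro rfl
          rfl
        · intro h
          ext1 j
          rw [← h, Fin.fin_one_eq_zero j]
          rfl
      · simp
    · refine ⟨∅, fun s => ?_, ?_⟩
      · simp [chainWeight, Ne.symm hn]
      · simp [MvPowerSeries.coeff_one, hn]
  | succ k ih =>
    choose F hF hFsum using ih (by omega)
    -- The last factor acts first on the ket. The finite support of the resulting vector gives the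
    -- possible preceding states, and this keeps the set of chains finite. Reading the relation off
    -- the support requires `1 ≠ 0` in `R`.
    let G : (ℤ →₀ ℕ) → Finset MayaDiagram := fun q =>
      (MvPowerSeries.coeff q (T k) (ket R r)).support
    have hG : ∀ q m, m ∈ G q ↔ rel k m r ∧ q = wt k m r := fun q m => by
      rw [Finsupp.mem_support_iff, hT k (by omega)]
      simp
    have hGsum : ∀ q, MvPowerSeries.coeff q (T k) (ket R r) = ∑ m ∈ G q, ket R m := fun q => by
      ext l
      rw [hT k (by omega), Finsupp.finsetSum_apply]
      simp only [ket_apply, Finset.sum_ite_eq', hG]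
    let H : Finset (Σ _ : (ℤ →₀ ℕ) × (ℤ →₀ ℕ), Σ _ : MayaDiagram, (Fin (k + 1) → MayaDiagram)) :=
      (Finset.HasAntidiagonal.antidiagonal n).sigma fun pq => (G pq.2).sigma fun m => F m pq.1
    have hH : ∀ z, z ∈ H ↔ z.1.1 + z.1.2 = n ∧ (rel k z.2.1 r ∧ z.1.2 = wt k z.2.1 r) ∧
        IsStateChain rel z.2.2 ∧ z.2.2 (Fin.last k) = z.2.1 ∧ chainWeight wt z.2.2 = z.1.1 := by
      intro z
      rw [Finset.mem_sigma, Finset.HasAntidiagonal.mem_antidiagonal, Finset.mem_sigma, hG, hF]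
    refine ⟨H.image fun z => Fin.snoc z.2.2 r, fun s => ?_, ?_⟩
    · rw [Finset.mem_image]
      constructor
      · rintro ⟨⟨⟨p, q⟩, m, s⟩, hz, rfl⟩
        obtain ⟨h1, ⟨h2, h3⟩, h4, h5, h6⟩ := (hH _).1 hz
        dsimp only at h1 h2 h3 h4 h5 h6 ⊢
        subst h5
        refine ⟨(isStateChain_snoc rel s r).2 ⟨h4, h2⟩, Fin.snoc_last _ _, ?_⟩
        rw [chainWeight_snoc, h6, ← h3, h1]
      · rintro ⟨h1, rfl, rfl⟩
        have hs := Fin.snoc_init_self s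
        rw [← hs, isStateChain_snoc] at h1
        refine ⟨⟨(chainWeight wt (Fin.init s), wt k (Fin.init s (Fin.last k)) (s (Fin.last _))),
          Fin.init s (Fin.last k), Fin.init s⟩, (hH _).2 ⟨?_, ⟨h1.2, rfl⟩, h1.1, rfl, rfl⟩, hs⟩
        rw [← chainWeight_snoc, hs]
    · rw [Finset.sum_image]
      · rw [List.range_succ, List.map_append, List.prod_append, List.map_singleton,
          List.prod_singleton, MvPowerSeries.coeff_mul, LinearMap.sum_apply, Finset.sum_sigma]
        refine Finset.sum_congr rfl fun pq _ => ?_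
        rw [Module.End.mul_apply, hGsum, map_sum, Finset.sum_sigma]
        refine Finset.sum_congr rfl fun m _ => ?_
        rw [hFsum]
        rfl
      -- The chain determines its intermediate state and both partial degrees, so no chain is
      -- counted twice.
      · rintro ⟨⟨p, q⟩, m, s⟩ hz ⟨⟨p', q'⟩, m', s'⟩ hz' h
        have hs : s = s' := by
          have := congrArg Fin.init h
          simpa only [Fin.init_snoc] using this
        obtain ⟨-, ⟨-, h1⟩, -, h2, h3⟩ := (hH _).1 hz
        obtain ⟨-, ⟨-, h1'⟩, -, h2', h3'⟩ := (hH _).1 hz'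
        dsimp only at h1 h2 h3 h1' h2' h3'
        subst hs h2
        subst h2' h1 h1' h3
        subst h3'
        rfl

end RailYard

namespace RailYard

/-! ### The partners of even vertices -/

/-- The side of a column on which its diagonal edges lie. -/
def LR.side : LR → ℤ
  | .L => -1
  | .R => 1

theorem LR.side_eq (a : LR) : a.side = 1 ∨ a.side = -1 := by
  cases a <;> simp [LR.side]

theorem diagNbr_eq (a : ℤ → LR) (b : ℤ → Sgn) (i y : ℤ) :
    diagNbr a b i y = (2 * i + (a i).side, y + (b i).toInt) := by
  unfold diagNbr
  cases a i <;> rfl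

/-- The ordinates of the even vertices which are covered on the side of the diagonal edges. -/
def columnSource (a : LR) (l r : Set ℤ) : Set ℤ :=
  match a with
  | .R => l
  | .L => rᶜ

/-- The ordinates of the odd vertices which are covered on the side of the diagonal edges. -/
def columnTarget (a : LR) (l r : Set ℤ) : Set ℤ :=
  match a with
  | .R => r
  | .L => lᶜ

theorem columnStrip_iff {a : LR} {s : Sgn} {l r D : Set ℤ} :
    ColumnStrip a s l r D ↔ Strip s.toInt (columnSource a l r) (columnTarget a l r) D := by
  cases a <;> rfl

open Classical in
/-- The odd vertex matched to the even vertex `(2 * i, y)`. -/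
noncomputable def partner (a : LR) (s : Sgn) (i : ℤ) (S D : Set ℤ) (y : ℤ) : Vertex :=
  if y ∈ S then (2 * i + a.side, stripMap s.toInt D y) else (2 * i - a.side, y)

section Partner

variable {a : LR} {s : Sgn} {i : ℤ} {S T D l r : Set ℤ}

theorem partner_of_mem {y : ℤ} (hy : y ∈ S) :
    partner a s i S D y = (2 * i + a.side, stripMap s.toInt D y) := if_pos hy

theorem partner_of_notMem {y : ℤ} (hy : y ∉ S) :
    partner a s i S D y = (2 * i - a.side, y) := if_neg hy

theorem partner_eq_far_iff {y k : ℤ} :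
    partner a s i S D y = (2 * i - a.side, k) ↔ y ∉ S ∧ y = k := by
  have := a.side_eq
  by_cases hy : y ∈ S
  · simp only [partner_of_mem hy, Prod.mk.injEq, hy, not_true, false_and, iff_false, not_and]
    omega
  · simp [partner_of_notMem hy, hy]

theorem partner_eq_near_iff {y k : ℤ} :
    partner a s i S D y = (2 * i + a.side, k) ↔ Moves s.toInt S D y k := by
  have := a.side_eq
  rw [moves_iff]
  by_cases hy : y ∈ S
  · simp [partner_of_mem hy, hy]
  · simp only [partner_of_notMem hy, Prod.mk.injEq, hy, false_and, iff_false, not_and]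
    omega

theorem partner_injective (h : Strip s.toInt S T D) : Function.Injective (partner a s i S D) := by
  intro y y' hyy
  by_cases hy : y ∈ S
  · rw [partner_of_mem hy, eq_comm, partner_eq_near_iff] at hyy
    exact (h.moves_injective s.toInt_eq hyy (moves_iff.2 ⟨hy, rfl⟩)).symm
  · rw [partner_of_notMem hy, eq_comm, partner_eq_far_iff] at hyy
    exact hyy.2.symm

theorem exists_partner_eq_left (h : ColumnStrip a s l r D) (k : ℤ) :
    (∃ y, partner a s i (columnSource a l r) D y = (2 * i - 1, k)) ↔ k ∉ l := by
  have hs := columnStrip_iff.1 h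
  cases a
  · refine (exists_congr fun y => partner_eq_near_iff (a := .L)).trans ?_
    exact (hs.mem_iff_exists_moves k).symm
  · refine (exists_congr fun y => partner_eq_far_iff (a := .R)).trans ?_
    simp [columnSource]

theorem exists_partner_eq_right (h : ColumnStrip a s l r D) (k : ℤ) :
    (∃ y, partner a s i (columnSource a l r) D y = (2 * i + 1, k)) ↔ k ∈ r := by
  have hs := columnStrip_iff.1 h
  cases a
  · have : 2 * i + 1 = 2 * i - LR.L.side := by simp [LR.side]
    rw [this]
    refine (exists_congr fun y => partner_eq_far_iff (a := .L)).trans ?_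
    simp [columnSource]
  · refine (exists_congr fun y => partner_eq_near_iff (a := .R)).trans ?_
    exact (hs.mem_iff_exists_moves k).symm

theorem partner_eq_diag_iff (h : D ⊆ S) {y : ℤ} :
    partner a s i S D y = (2 * i + a.side, y + s.toInt) ↔ y ∈ D := by
  have := s.toInt_eq
  rw [partner_eq_near_iff]
  constructor
  · rintro ⟨-, h | h⟩
    · omega
    · exact h.2
  · exact fun hy => ⟨h hy, Or.inr ⟨rfl, hy⟩⟩

/-- Moves describe the edges on the diagonal side and vacancies in the source set those on the
other; `partner` covers both at once. The hypothesis `hE` says that edges on the side without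
diagonals are horizontal. -/
theorem columnContains_iff {As Ds : List (Vertex × Vertex)}
    (hA : ∀ e ∈ As, e.1.1 = 2 * i ∧ e.2.1 = 2 * i - 1)
    (hD : ∀ e ∈ Ds, e.1.1 = 2 * i ∧ e.2.1 = 2 * i + 1)
    (hE : match a with
      | .R => ∀ e ∈ As, e.2.2 = e.1.2
      | .L => ∀ e ∈ Ds, e.2.2 = e.1.2) :
    ColumnContains a s (heights As) (heights Ds) l r D ↔
      ∀ e ∈ As ++ Ds, e.2 = partner a s i (columnSource a l r) D e.1.2 := by
  rw [List.forall_mem_append]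
  unfold ColumnContains heights
  cases a
  · simp only [List.forall_mem_map]
    refine and_congr (forall₂_congr fun e he => ?_) (forall₂_congr fun e he => ?_)
    · rw [eq_comm, ← Prod.mk.eta (p := e.2), (hA e he).2]
      exact (partner_eq_near_iff (a := .L)).symm
    · have : 2 * i + 1 = 2 * i - LR.L.side := by simp [LR.side]
      rw [eq_comm, ← Prod.mk.eta (p := e.2), (hD e he).2, this, partner_eq_far_iff]
      simp [columnSource, hE e he]
  · simp only [List.forall_mem_map]
    refine and_congr (forall₂_congr fun e he => ?_) (forall₂_congr fun e he => ?_)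
    · rw [eq_comm, ← Prod.mk.eta (p := e.2), (hA e he).2]
      refine Iff.symm ((partner_eq_far_iff (a := .R)).trans ?_)
      simp [columnSource, hE e he]
    · rw [eq_comm, ← Prod.mk.eta (p := e.2), (hD e he).2]
      exact (partner_eq_near_iff (a := .R)).symm

end Partner

/-! ### The graph -/

variable {ℓ r : ℤ} {a : ℤ → LR} {b : ℤ → Sgn}

theorem isEdge_iff {i y : ℤ} {w : Vertex} : IsEdge ℓ r a b (2 * i, y) w ↔ ℓ ≤ i ∧ i ≤ r ∧
    (w = (2 * i - (a i).side, y) ∨ w = (2 * i + (a i).side, y) ∨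
      w = (2 * i + (a i).side, y + (b i).toInt)) := by
  have hor : ∀ i y, (w = (2 * i - 1, y) ∨ w = (2 * i + 1, y) ∨ w = diagNbr a b i y) ↔
      (w = (2 * i - (a i).side, y) ∨ w = (2 * i + (a i).side, y) ∨
        w = (2 * i + (a i).side, y + (b i).toInt)) := fun i y => by
    rw [diagNbr_eq]
    rcases (a i).side_eq with h | h <;> rw [h]
    rw [sub_neg_eq_add, ← sub_eq_add_neg]
    tauto
  constructor
  · rintro ⟨m, z, h1, h2, h3, h4⟩
    rw [Prod.mk.injEq] at h3
    obtain ⟨h3, rfl⟩ := h3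
    obtain rfl : i = m := by omega
    exact ⟨h1, h2, (hor _ _).1 h4⟩
  · rintro ⟨h1, h2, h3⟩
    exact ⟨i, y, h1, h2, rfl, (hor _ _).2 h3⟩

theorem IsEdge.parity {v w : Vertex} (h : IsEdge ℓ r a b v w) :
    v.1 % 2 = 0 ∧ w.1 % 2 = 1 ∧ 2 * ℓ ≤ v.1 ∧ v.1 ≤ 2 * r ∧ (w.1 = v.1 - 1 ∨ w.1 = v.1 + 1) := by
  obtain ⟨i, y, h1, h2, rfl, -⟩ := id h
  rw [isEdge_iff] at h
  have := (a i).side_eq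
  obtain ⟨-, -, rfl | rfl | rfl⟩ := h <;> dsimp only <;> omega

theorem ryg_adj {v w : Vertex} :
    (ryg ℓ r a b).Adj v w ↔ IsEdge ℓ r a b v w ∨ IsEdge ℓ r a b w v := by
  unfold ryg
  rw [SimpleGraph.fromRel_adj]
  refine and_iff_right_of_imp ?_
  rintro h rfl
  rcases h with h | h <;> have := h.parity <;> omega

theorem ryg_adj_even {i y : ℤ} {w : Vertex} :
    (ryg ℓ r a b).Adj (2 * i, y) w ↔ IsEdge ℓ r a b (2 * i, y) w := by
  rw [ryg_adj, or_iff_left]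
  intro h
  have := h.parity
  dsimp only at this
  omega

/-- The even neighbour of an odd vertex. -/
theorem exists_even_of_ryg_adj {x k : ℤ} {w : Vertex} (hx : x % 2 = 1)
    (h : (ryg ℓ r a b).Adj (x, k) w) :
    ∃ i y, ℓ ≤ i ∧ i ≤ r ∧ w = (2 * i, y) ∧ (x = 2 * i - 1 ∨ x = 2 * i + 1) := by
  rcases ryg_adj.1 h with h | h
  · have := h.parity
    dsimp only at this
    omega
  · have h1 := h.parity
    obtain ⟨i, y, h2, h3, rfl, -⟩ := h
    refine ⟨i, y, h2, h3, rfl, ?_⟩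
    dsimp only at h1
    omega

/-! ### The boundary states of the columns of a covering -/

namespace AdmissibleCovering

variable (C : AdmissibleCovering ℓ r a b)

@[ext]
theorem ext {C C' : AdmissibleCovering ℓ r a b} (h : C.dimers = C'.dimers) : C = C' := by
  cases C
  cases C'
  congr

theorem mem_verts_iff (v : Vertex) : v ∈ C.dimers.verts ↔ ∃ w, C.dimers.Adj v w :=
  ⟨fun h => (C.isMatching h).exists, fun ⟨_, h⟩ => C.dimers.edge_vert h⟩

variable {C} in
theorem adj_unique {v w w' : Vertex} (h : C.dimers.Adj v w) (h' : C.dimers.Adj v w') : w = w' :=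
  (C.isMatching (C.dimers.edge_vert h)).unique h h'

open Classical in
/-- The sites of the black marbles on the abscissa `2 * i - 1`. -/
def colBlack (i : ℤ) : Set ℤ :=
  {k | if i = ℓ then (2 * ℓ - 1, k) ∉ C.dimers.verts
    else ∃ y, C.dimers.Adj (2 * (i - 1), y) (2 * i - 1, k)}

/-- The ordinates of the even end points of the diagonal dimers of a column. -/
def diagSet (i : ℤ) : Set ℤ :=
  {y | C.dimers.Adj (2 * i, y) (diagNbr a b i y)}

theorem colBlack_left : C.colBlack ℓ = C.leftState.black := by
  ext k
  simp [colBlack, leftState]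

theorem exists_adj_right {i : ℤ} (hi : ℓ ≤ i) (k : ℤ) :
    (∃ y, C.dimers.Adj (2 * i, y) (2 * i + 1, k)) ↔ k ∈ C.colBlack (i + 1) := by
  have h1 : i + 1 ≠ ℓ := by omega
  have h2 : 2 * (i + 1) - 1 = 2 * i + 1 := by ring
  simp [colBlack, h1, h2]

theorem colBlack_right (h : ℓ ≤ r) : C.colBlack (r + 1) = C.rightState.black := by
  ext k
  rw [← C.exists_adj_right h]
  change _ ↔ (2 * r + 1, k) ∈ C.dimers.verts
  rw [mem_verts_iff]
  constructor
  · rintro ⟨y, hy⟩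
    exact ⟨_, hy.symm⟩
  · rintro ⟨w, hw⟩
    obtain ⟨i, y, h1, h2, rfl, h3⟩ := exists_even_of_ryg_adj (by omega) hw.adj_sub
    obtain rfl : i = r := by omega
    exact ⟨y, hw.symm⟩

/-- An inner odd vertex is covered from exactly one of its two neighbouring columns, so white means
covered from the right. On the left boundary this is the convention defining the state. -/
theorem exists_adj_left {i : ℤ} (hi : ℓ ≤ i) (hr : i ≤ r) (k : ℤ) :
    (∃ y, C.dimers.Adj (2 * i, y) (2 * i - 1, k)) ↔ k ∉ C.colBlack i := by
  by_cases h : i = ℓ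
  · subst h
    rw [colBlack_left]
    change _ ↔ ¬ (2 * i - 1, k) ∉ C.dimers.verts
    rw [not_not, mem_verts_iff]
    constructor
    · rintro ⟨y, hy⟩
      exact ⟨_, hy.symm⟩
    · rintro ⟨w, hw⟩
      obtain ⟨j, y, h1, h2, rfl, h3⟩ := exists_even_of_ryg_adj (by omega) hw.adj_sub
      obtain rfl : j = i := by omega
      exact ⟨y, hw.symm⟩
  · simp only [colBlack, h, if_false, Set.mem_ofPred_eq]
    constructor
    · rintro ⟨y, hy⟩ ⟨y', hy'⟩
      have := congrArg Prod.fst (adj_unique hy.symm hy'.symm)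
      dsimp only at this
      omega
    · intro hk
      obtain ⟨w, hw⟩ := (C.mem_verts_iff (2 * i - 1, k)).1
        (C.inner_covered _ (by dsimp only; omega) (by dsimp only; omega))
      obtain ⟨j, y, h1, h2, rfl, h3⟩ := exists_even_of_ryg_adj (by omega) hw.adj_sub
      by_cases hj : j = i
      · subst hj
        exact ⟨y, hw.symm⟩
      · obtain rfl : j = i - 1 := by omega
        exact absurd ⟨y, hw.symm⟩ hk

theorem adj_cases {i : ℤ} (hi : ℓ ≤ i) (hr : i ≤ r) (y : ℤ) :
    C.dimers.Adj (2 * i, y) (2 * i - (a i).side, y) ∨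
      C.dimers.Adj (2 * i, y) (2 * i + (a i).side, y) ∨
      C.dimers.Adj (2 * i, y) (2 * i + (a i).side, y + (b i).toInt) := by
  obtain ⟨w, hw⟩ := (C.mem_verts_iff (2 * i, y)).1
    (C.inner_covered _ (by dsimp only; omega) (by dsimp only; omega))
  obtain ⟨-, -, rfl | rfl | rfl⟩ := isEdge_iff.1 (ryg_adj_even.1 hw.adj_sub)
  · exact Or.inl hw
  · exact Or.inr (Or.inl hw)
  · exact Or.inr (Or.inr hw)

theorem mem_diagSet {i y : ℤ} : y ∈ C.diagSet i ↔
    C.dimers.Adj (2 * i, y) (2 * i + (a i).side, y + (b i).toInt) := by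
  rw [← diagNbr_eq]
  rfl

theorem exists_adj_far {i k : ℤ} : (∃ y, C.dimers.Adj (2 * i, y) (2 * i - (a i).side, k)) ↔
    C.dimers.Adj (2 * i, k) (2 * i - (a i).side, k) := by
  refine ⟨?_, fun h => ⟨k, h⟩⟩
  rintro ⟨y, hy⟩
  have := (a i).side_eq
  obtain ⟨-, -, h | h | h⟩ := isEdge_iff.1 (ryg_adj_even.1 hy.adj_sub) <;>
    rw [Prod.mk.injEq] at h
  · rwa [h.2] at hy ⊢
  · omega
  · omega

theorem exists_adj_near {i k : ℤ} : (∃ y, C.dimers.Adj (2 * i, y) (2 * i + (a i).side, k)) ↔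
    C.dimers.Adj (2 * i, k) (2 * i + (a i).side, k) ∨ k - (b i).toInt ∈ C.diagSet i := by
  constructor
  · rintro ⟨y, hy⟩
    have := (a i).side_eq
    obtain ⟨-, -, h | h | h⟩ := isEdge_iff.1 (ryg_adj_even.1 hy.adj_sub) <;>
      rw [Prod.mk.injEq] at h
    · omega
    · obtain ⟨-, rfl⟩ := h
      exact Or.inl hy
    · obtain ⟨-, rfl⟩ := h
      refine Or.inr (C.mem_diagSet.2 ?_)
      rwa [add_sub_cancel_right]
  · rintro (h | h)
    · exact ⟨k, h⟩
    · have := C.mem_diagSet.1 h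
      rw [sub_add_cancel] at this
      exact ⟨_, this⟩

end AdmissibleCovering

end RailYard

/-! ### The columns of a covering are strips, and the states determine the covering -/

namespace RailYard

variable {ℓ r : ℤ} {a : ℤ → LR} {b : ℤ → Sgn}

theorem diagEdge_injective (a : ℤ → LR) (b : ℤ → Sgn) (i : ℤ) :
    Function.Injective fun y : ℤ => s(((2 * i, y) : Vertex), diagNbr a b i y) := by
  intro y y' h
  dsimp only at h
  have := (a i).side_eq
  rw [diagNbr_eq, diagNbr_eq, Sym2.eq_iff] at h
  simp only [Prod.mk.injEq] at h
  omega

/-- A strip changes only the finitely many sites left or reached by displaced particles. Being a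
Maya diagram therefore propagates from one state to the next. -/
theorem ColumnStrip.eventually_mem_iff {a : LR} {s : Sgn} {l r D : Set ℤ}
    (h : ColumnStrip a s l r D) : ∀ᶠ k in Filter.cofinite, k ∈ r ↔ k ∈ l := by
  have key : ∀ {S T : Set ℤ}, Strip s.toInt S T D → ∀ᶠ k in Filter.cofinite, k ∈ T ↔ k ∈ S := by
    intro S T h
    filter_upwards [h.finite.compl_mem_cofinite,
      (h.finite.preimage (sub_left_injective (b := s.toInt)).injOn).compl_mem_cofinite] with k h1 h2
    rw [h.mem_iff, or_iff_left (show ¬ (k - s.toInt ∈ D) from h2),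
      and_iff_left (show k ∉ D from h1)]
  cases a
  · filter_upwards [key h] with k hk
    exact (not_iff_not.1 hk).symm
  · exact key h

theorem ColumnStrip.exists_mayaDiagram {a : LR} {s : Sgn} {l : MayaDiagram} {r D : Set ℤ}
    (h : ColumnStrip a s l.black r D) : ∃ m : MayaDiagram, m.black = r := by
  have h1 := h.eventually_mem_iff
  rw [Int.cofinite_eq, Filter.eventually_sup] at h1
  refine ⟨⟨r, ?_, ?_⟩, rfl⟩
  · filter_upwards [h1.1, l.eventually_black] with k h2 h3
    exact h2.2 h3
  · filter_upwards [h1.2, l.eventually_white] with k h2 h3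
    exact fun h4 => h3 (h2.1 h4)

namespace AdmissibleCovering

section

variable (C : AdmissibleCovering ℓ r a b)

theorem diagCount_eq (i : ℤ) : C.diagCount i = (C.diagSet i).ncard := by
  rw [diagCount, ← Set.ncard_image_of_injective _ (diagEdge_injective a b i)]
  congr 1
  ext e
  constructor
  · rintro ⟨h, y, rfl⟩
    exact ⟨y, h, rfl⟩
  · rintro ⟨y, h, rfl⟩
    exact ⟨h, y, rfl⟩

theorem finite_diagSet (i : ℤ) : (C.diagSet i).Finite := by
  refine Set.Finite.of_finite_image (f := fun y : ℤ => s(((2 * i, y) : Vertex), diagNbr a b i y))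
    (C.finite_diagonals.subset ?_) (diagEdge_injective a b i).injOn
  rintro - ⟨y, h, rfl⟩
  exact ⟨h, Set.mem_iUnion.2 ⟨i, y, rfl⟩⟩

theorem mem_columnSource {i : ℤ} (hi : ℓ ≤ i) (hr : i ≤ r) (y : ℤ) :
    y ∈ columnSource (a i) (C.colBlack i) (C.colBlack (i + 1)) ↔
      ¬ C.dimers.Adj (2 * i, y) (2 * i - (a i).side, y) := by
  rw [← C.exists_adj_far]
  cases a i
  · rw [LR.side, sub_neg_eq_add, C.exists_adj_right hi]
    rfl
  · rw [LR.side, C.exists_adj_left hi hr, not_not]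
    rfl

theorem mem_columnTarget {i : ℤ} (hi : ℓ ≤ i) (hr : i ≤ r) (k : ℤ) :
    k ∈ columnTarget (a i) (C.colBlack i) (C.colBlack (i + 1)) ↔
      C.dimers.Adj (2 * i, k) (2 * i + (a i).side, k) ∨ k - (b i).toInt ∈ C.diagSet i := by
  rw [← C.exists_adj_near]
  cases a i
  · rw [LR.side, ← sub_eq_add_neg, C.exists_adj_left hi hr]
    rfl
  · rw [LR.side, C.exists_adj_right hi]
    rfl

/-- The exclusion rule comes from the matching: if the diagonal at `k` is covered, it uses up the
horizontal neighbour, on the diagonal side, of the even vertex at `k + (b i).toInt`; that vertex, if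
matched on this side, must take its own diagonal. -/
theorem columnStrip {i : ℤ} (hi : ℓ ≤ i) (hr : i ≤ r) :
    ColumnStrip (a i) (b i) (C.colBlack i) (C.colBlack (i + 1)) (C.diagSet i) := by
  have hside := (a i).side_eq
  have hsgn := (b i).toInt_eq
  have hPD : ∀ y, y ∈ C.diagSet i → ¬ C.dimers.Adj (2 * i, y) (2 * i - (a i).side, y) := by
    intro y h h'
    have := congrArg Prod.fst (adj_unique (C.mem_diagSet.1 h) h')
    dsimp only at this
    omega
  have hQD : ∀ y, y ∈ C.diagSet i → ¬ C.dimers.Adj (2 * i, y) (2 * i + (a i).side, y) := by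
    intro y h h'
    have := congrArg Prod.snd (adj_unique (C.mem_diagSet.1 h) h')
    dsimp only at this
    omega
  rw [columnStrip_iff]
  refine ⟨fun y hy => ?_, C.finite_diagSet i, fun k hk hk' => ?_, fun k => ?_⟩
  · rw [C.mem_columnSource hi hr]
    exact hPD y hy
  · rw [C.mem_columnSource hi hr] at hk'
    rcases C.adj_cases hi hr (k + (b i).toInt) with h | h | h
    · exact absurd h hk'
    · have := congrArg Prod.snd (adj_unique h.symm (C.mem_diagSet.1 hk).symm)
      dsimp only at this
      omega
    · exact C.mem_diagSet.2 h
  · rw [C.mem_columnTarget hi hr, C.mem_columnSource hi hr]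
    refine or_congr_left ⟨fun h => ⟨fun h' => ?_, fun h' => hQD k h' h⟩, fun h => ?_⟩
    · have := congrArg Prod.fst (adj_unique h h')
      dsimp only at this
      omega
    · rcases C.adj_cases hi hr k with h' | h' | h'
      · exact absurd h' h.1
      · exact h'
      · exact absurd (C.mem_diagSet.2 h') h.2

theorem adj_iff {i : ℤ} (hi : ℓ ≤ i) (hr : i ≤ r) (y : ℤ) (w : Vertex) :
    C.dimers.Adj (2 * i, y) w ↔ w = partner (a i) (b i) i
      (columnSource (a i) (C.colBlack i) (C.colBlack (i + 1))) (C.diagSet i) y := by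
  have key : C.dimers.Adj (2 * i, y) (partner (a i) (b i) i
      (columnSource (a i) (C.colBlack i) (C.colBlack (i + 1))) (C.diagSet i) y) := by
    have hsrc := C.mem_columnSource hi hr y
    by_cases hy : y ∈ columnSource (a i) (C.colBlack i) (C.colBlack (i + 1))
    · rw [partner_of_mem hy, stripMap]
      split_ifs with hD
      · exact C.mem_diagSet.1 hD
      · exact ((C.adj_cases hi hr y).resolve_left (hsrc.1 hy)).resolve_right
          fun h => hD (C.mem_diagSet.2 h)
    · rw [partner_of_notMem hy]
      exact not_not.1 fun h => hy (hsrc.2 h)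
  exact ⟨fun h => adj_unique h key, fun h => h ▸ key⟩

theorem exists_state {i : ℤ} (hi : ℓ ≤ i) (hr : i ≤ r + 1) :
    ∃ m : MayaDiagram, m.black = C.colBlack i := by
  induction i, hi using Int.leInduction with
  | base => exact ⟨_, C.colBlack_left.symm⟩
  | succ i hi ih =>
    obtain ⟨m, hm⟩ := ih (by omega)
    have h := C.columnStrip hi (by omega)
    rw [← hm] at h
    exact h.exists_mayaDiagram

/-- Equal states give equal diagonal sets by uniqueness of strips, and states and diagonals together
fix the partner of every even vertex. -/
theorem adj_of_colBlack_eq {C C' : AdmissibleCovering ℓ r a b}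
    (h : ∀ i, ℓ ≤ i → i ≤ r + 1 → C.colBlack i = C'.colBlack i) {v w : Vertex}
    (hvw : C.dimers.Adj v w) : C'.dimers.Adj v w := by
  have key : ∀ v w, IsEdge ℓ r a b v w → C.dimers.Adj v w → C'.dimers.Adj v w := by
    rintro v w ⟨i, y, hi, hr, rfl, -⟩ hvw
    have hD : C.diagSet i = C'.diagSet i := by
      obtain ⟨m, hm⟩ := C.exists_state hi (by omega)
      obtain ⟨m', hm'⟩ := C.exists_state (i := i + 1) (by omega) (by omega)
      have h1 := C.columnStrip hi hr
      have h2 := C'.columnStrip hi hr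
      rw [← h i hi (by omega), ← h (i + 1) (by omega) (by omega)] at h2
      rw [← hm, ← hm'] at h1 h2
      exact h1.unique h2
    rw [adj_iff _ hi hr] at hvw ⊢
    rwa [← h i hi (by omega), ← h (i + 1) (by omega) (by omega), ← hD]
  rcases ryg_adj.1 hvw.adj_sub with h1 | h1
  · exact key v w h1 hvw
  · exact (key w v h1 hvw.symm).symm

theorem eq_of_colBlack_eq {C C' : AdmissibleCovering ℓ r a b}
    (h : ∀ i, ℓ ≤ i → i ≤ r + 1 → C.colBlack i = C'.colBlack i) : C = C' := by
  have hadj : ∀ v w, C.dimers.Adj v w ↔ C'.dimers.Adj v w := fun v w =>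
    ⟨adj_of_colBlack_eq h, adj_of_colBlack_eq fun i hi hr => (h i hi hr).symm⟩
  refine ext (SimpleGraph.Subgraph.ext ?_ ?_)
  · ext v
    simp only [mem_verts_iff, hadj]
  · ext v w
    exact hadj v w

end

/-! ### The covering with given states -/

section OfStates

variable (ℓ r a b) in
/-- The dimers, oriented from even to odd vertices, determined by the states of a covering and the
positions of its diagonal dimers. -/
def IsDimer (st Dg : ℤ → Set ℤ) (v w : Vertex) : Prop :=
  ∃ i y : ℤ, ℓ ≤ i ∧ i ≤ r ∧ v = (2 * i, y) ∧
    w = partner (a i) (b i) i (columnSource (a i) (st i) (st (i + 1))) (Dg i) y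

variable {st Dg : ℤ → Set ℤ}

theorem IsDimer.isEdge {v w : Vertex} (h : IsDimer ℓ r a b st Dg v w) : IsEdge ℓ r a b v w := by
  obtain ⟨i, y, hi, hr, rfl, rfl⟩ := h
  refine isEdge_iff.2 ⟨hi, hr, ?_⟩
  by_cases hy : y ∈ columnSource (a i) (st i) (st (i + 1))
  · rw [partner_of_mem hy, stripMap]
    split_ifs
    · exact Or.inr (Or.inr rfl)
    · exact Or.inr (Or.inl rfl)
  · exact Or.inl (partner_of_notMem hy)

theorem isDimer_even_iff {i y : ℤ} {w : Vertex} : IsDimer ℓ r a b st Dg (2 * i, y) w ↔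
    ℓ ≤ i ∧ i ≤ r ∧
      w = partner (a i) (b i) i (columnSource (a i) (st i) (st (i + 1))) (Dg i) y := by
  constructor
  · rintro ⟨j, z, h1, h2, h3, h4⟩
    rw [Prod.mk.injEq] at h3
    obtain ⟨h3, rfl⟩ := h3
    obtain rfl : i = j := by omega
    exact ⟨h1, h2, h4⟩
  · rintro ⟨h1, h2, h3⟩
    exact ⟨i, y, h1, h2, rfl, h3⟩

theorem exists_isDimer_left (h : ∀ i, ℓ ≤ i → i ≤ r →
    ColumnStrip (a i) (b i) (st i) (st (i + 1)) (Dg i)) {i k : ℤ} (hi : ℓ ≤ i) (hr : i ≤ r) :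
    (∃ y, IsDimer ℓ r a b st Dg (2 * i, y) (2 * i - 1, k)) ↔ k ∉ st i := by
  rw [← exists_partner_eq_left (i := i) (h i hi hr)]
  simp only [isDimer_even_iff, hi, hr, true_and]
  exact exists_congr fun y => eq_comm

theorem exists_isDimer_right (h : ∀ i, ℓ ≤ i → i ≤ r →
    ColumnStrip (a i) (b i) (st i) (st (i + 1)) (Dg i)) {i k : ℤ} (hi : ℓ ≤ i) (hr : i ≤ r) :
    (∃ y, IsDimer ℓ r a b st Dg (2 * i, y) (2 * i + 1, k)) ↔ k ∈ st (i + 1) := by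
  rw [← exists_partner_eq_right (i := i) (h i hi hr)]
  simp only [isDimer_even_iff, hi, hr, true_and]
  exact exists_congr fun y => eq_comm

/-- Within one column this is the injectivity of the strip. Two adjacent columns cannot claim the
same odd vertex, since one would need it black and the other white. -/
theorem isDimer_injective (h : ∀ i, ℓ ≤ i → i ≤ r →
    ColumnStrip (a i) (b i) (st i) (st (i + 1)) (Dg i)) {v v' w : Vertex}
    (hv : IsDimer ℓ r a b st Dg v w) (hv' : IsDimer ℓ r a b st Dg v' w) : v = v' := by
  have key : ∀ {i y y' k : ℤ}, IsDimer ℓ r a b st Dg (2 * i, y) (2 * i + 1, k) →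
      IsDimer ℓ r a b st Dg (2 * (i + 1), y') (2 * i + 1, k) → False := by
    intro i y y' k h1 h2
    have hi := (isDimer_even_iff.1 h1).1
    have hr := (isDimer_even_iff.1 h2).2.1
    have h3 := (exists_isDimer_right h hi (by omega)).1 ⟨y, h1⟩
    have e : 2 * i + 1 = 2 * (i + 1) - 1 := by ring
    rw [e] at h2
    exact (exists_isDimer_left h (by omega) hr).1 ⟨y', h2⟩ h3
  have p := hv.isEdge.parity
  have p' := hv'.isEdge.parity
  obtain ⟨i, y, hi, hr, rfl, hw⟩ := id hv
  obtain ⟨i', y', hi', hr', rfl, hw'⟩ := id hv'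
  obtain ⟨x, k⟩ := w
  dsimp only at p p'
  have hx : i = i' ∨ (x = 2 * i + 1 ∧ i' = i + 1) ∨ (x = 2 * i' + 1 ∧ i = i' + 1) := by omega
  rcases hx with rfl | ⟨rfl, rfl⟩ | ⟨rfl, rfl⟩
  · rw [partner_injective (columnStrip_iff.1 (h i hi hr)) (hw.symm.trans hw')]
  · exact (key hv hv').elim
  · exact (key hv' hv).elim

theorem isDimer_unique {v w w' : Vertex} (hw : IsDimer ℓ r a b st Dg v w)
    (hw' : IsDimer ℓ r a b st Dg v w') : w = w' := by
  obtain ⟨i, y, hi, hr, rfl, rfl⟩ := hw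
  exact (isDimer_even_iff.1 hw').2.2.symm

/-- The subgraph determined by the states of a covering. -/
def dimersOfStates (st Dg : ℤ → Set ℤ) : (ryg ℓ r a b).Subgraph where
  verts := {v | ∃ w, IsDimer ℓ r a b st Dg v w ∨ IsDimer ℓ r a b st Dg w v}
  Adj v w := IsDimer ℓ r a b st Dg v w ∨ IsDimer ℓ r a b st Dg w v
  adj_sub h := ryg_adj.2 (h.imp IsDimer.isEdge IsDimer.isEdge)
  edge_vert h := ⟨_, h⟩
  symm := ⟨fun _ _ h => h.symm⟩

theorem mem_verts_dimersOfStates_left (h : ∀ i, ℓ ≤ i → i ≤ r →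
    ColumnStrip (a i) (b i) (st i) (st (i + 1)) (Dg i)) (hlr : ℓ ≤ r) (k : ℤ) :
    (2 * ℓ - 1, k) ∈ (dimersOfStates st Dg : (ryg ℓ r a b).Subgraph).verts ↔ k ∉ st ℓ := by
  rw [← exists_isDimer_left h le_rfl hlr]
  constructor
  · rintro ⟨w, hw | hw⟩
    · have := hw.isEdge.parity
      dsimp only at this
      omega
    · have := hw.isEdge.parity
      obtain ⟨i, y, hi, hr, rfl, -⟩ := id hw
      obtain rfl : i = ℓ := by
        dsimp only at this
        omega
      exact ⟨y, hw⟩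
  · rintro ⟨y, hy⟩
    exact ⟨_, Or.inr hy⟩

theorem mem_verts_dimersOfStates_right (h : ∀ i, ℓ ≤ i → i ≤ r →
    ColumnStrip (a i) (b i) (st i) (st (i + 1)) (Dg i)) (hlr : ℓ ≤ r) (k : ℤ) :
    (2 * r + 1, k) ∈ (dimersOfStates st Dg : (ryg ℓ r a b).Subgraph).verts ↔ k ∈ st (r + 1) := by
  rw [← exists_isDimer_right h hlr le_rfl]
  constructor
  · rintro ⟨w, hw | hw⟩
    · have := hw.isEdge.parity
      dsimp only at this
      omega
    · have := hw.isEdge.parity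
      obtain ⟨i, y, hi, hr, rfl, -⟩ := id hw
      obtain rfl : i = r := by
        dsimp only at this
        omega
      exact ⟨y, hw⟩
  · rintro ⟨y, hy⟩
    exact ⟨_, Or.inr hy⟩

/-- The covering determined by its states. -/
def ofStates (hlr : ℓ ≤ r) (st : ℤ → MayaDiagram) (Dg : ℤ → Set ℤ)
    (h : ∀ i, ℓ ≤ i → i ≤ r →
      ColumnStrip (a i) (b i) (st i).black (st (i + 1)).black (Dg i)) :
    AdmissibleCovering ℓ r a b where
  dimers := dimersOfStates (fun i => (st i).black) Dg
  isMatching := by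
    rintro v ⟨w, hw⟩
    refine ⟨w, hw, fun w' hw' => ?_⟩
    rcases hw with hw | hw <;> rcases hw' with hw' | hw'
    · exact isDimer_unique hw' hw
    · have := hw.isEdge.parity
      have := hw'.isEdge.parity
      omega
    · have := hw.isEdge.parity
      have := hw'.isEdge.parity
      omega
    · exact isDimer_injective (st := fun i => (st i).black) h hw' hw
  inner_covered := by
    rintro ⟨x, k⟩ h1 h2
    dsimp only at h1 h2
    rcases Int.even_or_odd' x with ⟨i, rfl | rfl⟩
    · exact ⟨_, Or.inl ⟨i, k, by omega, by omega, rfl, rfl⟩⟩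
    -- An inner odd vertex has a column on each side; its colour tells which one covers it.
    · by_cases hk : k ∈ (st (i + 1)).black
      · obtain ⟨y, hy⟩ := (exists_isDimer_right (st := fun i => (st i).black) h
          (by omega) (by omega)).2 hk
        exact ⟨_, Or.inr hy⟩
      · obtain ⟨y, hy⟩ := (exists_isDimer_left (st := fun i => (st i).black) h (i := i + 1)
          (by omega) (by omega)).2 hk
        have e : 2 * (i + 1) - 1 = 2 * i + 1 := by ring
        rw [e] at hy
        exact ⟨_, Or.inr hy⟩
  boundary := by
    obtain ⟨M, hM⟩ := Filter.eventually_atTop.1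
      ((st ℓ).eventually_white.and (st (r + 1)).eventually_white)
    obtain ⟨M', hM'⟩ := Filter.eventually_atBot.1
      ((st ℓ).eventually_black.and (st (r + 1)).eventually_black)
    refine ⟨max M.toNat (-M').toNat, fun y => ?_⟩
    rw [mem_verts_dimersOfStates_left (st := fun i => (st i).black) h hlr,
      mem_verts_dimersOfStates_right (st := fun i => (st i).black) h hlr, not_not]
    exact ⟨fun hy => hM y (by omega), fun hy => hM' y (by omega)⟩
  finite_diagonals := by
    refine Set.Finite.subset ((Finset.Icc ℓ r).finite_toSet.biUnion fun i hi =>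
      ((h i (Finset.mem_Icc.1 hi).1 (Finset.mem_Icc.1 hi).2).finite.image
        fun y : ℤ => s(((2 * i, y) : Vertex), diagNbr a b i y))) ?_
    rintro e ⟨he, hd⟩
    obtain ⟨i, y, rfl⟩ := Set.mem_iUnion.1 hd
    rcases he with he | he
    · rw [isDimer_even_iff] at he
      obtain ⟨hi, hr, he⟩ := he
      have hD := (columnStrip_iff.1 (h i hi hr)).subset
      rw [diagNbr_eq, eq_comm, partner_eq_diag_iff hD] at he
      exact Set.mem_biUnion (Finset.mem_coe.2 (Finset.mem_Icc.2 ⟨hi, hr⟩)) ⟨y, he, rfl⟩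
    · have := he.isEdge.parity
      dsimp only at this
      omega

theorem colBlack_ofStates (hlr : ℓ ≤ r) (st : ℤ → MayaDiagram) (Dg : ℤ → Set ℤ)
    (h : ∀ i, ℓ ≤ i → i ≤ r →
      ColumnStrip (a i) (b i) (st i).black (st (i + 1)).black (Dg i)) {i : ℤ} (hi : ℓ ≤ i)
    (hr : i ≤ r + 1) : (ofStates hlr st Dg h).colBlack i = (st i).black := by
  ext k
  by_cases hil : i = ℓ
  · subst hil
    rw [colBlack_left]
    exact not_iff_comm.1 (not_iff_comm.1 (not_iff_not.2
      (mem_verts_dimersOfStates_left (st := fun i => (st i).black) h hlr k))) |>.trans not_not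
  · obtain ⟨i, rfl⟩ : ∃ j, i = j + 1 := ⟨i - 1, by ring⟩
    rw [← exists_adj_right _ (by omega)]
    refine Iff.trans (exists_congr fun y => ?_)
      (exists_isDimer_right (st := fun i => (st i).black) h (i := i) (by omega) (by omega))
    refine or_iff_left fun h' => ?_
    have := h'.isEdge.parity
    dsimp only at this
    omega

end OfStates

end AdmissibleCovering

end RailYard

namespace RailYard

variable {ℓ r : ℤ} {a : ℤ → LR} {b : ℤ → Sgn} {E : Finset (Sym2 Vertex)}
  {A D : ℤ → List (Vertex × Vertex)}

/-! ### The edges of `E` in a column -/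

theorem IsColumnDecomposition.mem_append_iff (hAD : IsColumnDecomposition E A D) {i : ℤ}
    {e : Vertex × Vertex} : e ∈ A i ++ D i ↔
      s(e.1, e.2) ∈ E ∧ e.1.1 = 2 * i ∧ (e.2.1 = 2 * i - 1 ∨ e.2.1 = 2 * i + 1) := by
  rw [List.mem_append, ← Prod.mk.eta (p := e), (hAD i).2.2.1, (hAD i).2.2.2]
  tauto

theorem IsColumnDecomposition.cases (hAD : IsColumnDecomposition E A D)
    (hE : (E : Set (Sym2 Vertex)) ⊆ (ryg ℓ r a b).edgeSet) {i : ℤ} {e : Vertex × Vertex}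
    (he : e ∈ A i ++ D i) : e.1 = (2 * i, e.1.2) ∧ (e.2 = (2 * i - (a i).side, e.1.2) ∨
      e.2 = (2 * i + (a i).side, e.1.2) ∨
      e.2 = (2 * i + (a i).side, e.1.2 + (b i).toInt)) := by
  obtain ⟨h1, h2, -⟩ := hAD.mem_append_iff.1 he
  have h3 : e.1 = (2 * i, e.1.2) := Prod.ext h2 rfl
  have h4 : (ryg ℓ r a b).Adj e.1 e.2 := hE h1
  rw [h3, ryg_adj_even, isEdge_iff] at h4
  exact ⟨h3, h4.2.2⟩

theorem heights_nodup {es : List (Vertex × Vertex)} (hes : es.Nodup) {x x' : ℤ}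
    (h : ∀ e ∈ es, e.1.1 = x ∧ e.2.1 = x') : (heights es).Nodup := by
  refine hes.map_on fun e he e' he' hee => ?_
  rw [Prod.mk.injEq] at hee
  have h1 := h e he
  have h2 := h e' he'
  exact Prod.ext (Prod.ext (h1.1.trans h2.1.symm) hee.1) (Prod.ext (h1.2.trans h2.2.symm) hee.2)

/-- Counting the diagonal edges among the listed edges. -/
theorem countP_heights_eq_numDiag {i : ℤ} {es : List (Vertex × Vertex)} (hes : es.Nodup)
    (hmem : ∀ e, e ∈ es ↔ s(e.1, e.2) ∈ E ∧ e.1.1 = 2 * i ∧ e.2.1 = 2 * i + (a i).side)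
    (hst : ∀ e ∈ es, e.2.2 = e.1.2 ∨ e.2.2 = e.1.2 + (b i).toInt) :
    (heights es).countP (fun e => e.1 ≠ e.2) = numDiag a b E i := by
  classical
  have hsgn := (b i).toInt_eq
  have hside := (a i).side_eq
  rw [heights, List.countP_map, List.countP_eq_length_filter,
    ← List.toFinset_card_of_nodup (hes.filter _), ← Set.ncard_coe_finset, numDiag]
  refine Set.ncard_congr (fun e _ => s(e.1, e.2)) ?_ ?_ ?_
  · intro e he
    simp only [List.coe_toFinset, List.mem_filter, Set.mem_ofPred_eq, Function.comp_apply,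
      decide_eq_true_eq] at he
    obtain ⟨h1, h2, h3⟩ := (hmem e).1 he.1
    refine ⟨h1, e.1.2, ?_⟩
    rw [diagNbr_eq, ← h3, ← (hst e he.1).resolve_left (Ne.symm he.2), ← h2]
  · intro e e' he he' hee
    simp only [List.coe_toFinset, List.mem_filter, Set.mem_ofPred_eq] at he he'
    have h1 := ((hmem e).1 he.1).2
    have h2 := ((hmem e').1 he'.1).2
    rcases Sym2.eq_iff.1 hee with h | h
    · exact Prod.ext h.1 h.2
    · have := congrArg Prod.fst h.1
      omega
  · rintro e ⟨he, y, rfl⟩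
    rw [diagNbr_eq] at he ⊢
    refine ⟨((2 * i, y), (2 * i + (a i).side, y + (b i).toInt)), ?_, rfl⟩
    simp only [List.coe_toFinset, List.mem_filter, Set.mem_ofPred_eq, Function.comp_apply,
      decide_eq_true_eq]
    exact ⟨(hmem _).2 ⟨he, rfl, rfl⟩, by omega⟩

theorem IsColumnDecomposition.columnEdges (hAD : IsColumnDecomposition E A D)
    (hE : (E : Set (Sym2 Vertex)) ⊆ (ryg ℓ r a b).edgeSet) (i : ℤ) :
    ColumnEdges (a i) (b i) (heights (A i)) (heights (D i)) (numDiag a b E i) := by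
  have hc := fun e he => hAD.cases hE (i := i) (e := e) he
  obtain ⟨hA, hD, hA', hD'⟩ := hAD i
  have hA2 : ∀ e ∈ A i, e.1.1 = 2 * i ∧ e.2.1 = 2 * i - 1 := fun e he => ((hA' e.1 e.2).1 he).2
  have hD2 : ∀ e ∈ D i, e.1.1 = 2 * i ∧ e.2.1 = 2 * i + 1 := fun e he => ((hD' e.1 e.2).1 he).2
  have hcA := fun e he => (hc e (List.mem_append_left _ he)).2
  have hcD := fun e he => (hc e (List.mem_append_right _ he)).2
  simp only [Prod.ext_iff] at hcA hcD
  have hcount := fun es => countP_heights_eq_numDiag (E := E) (a := a) (b := b) (i := i) (es := es)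
  refine ⟨heights_nodup hA hA2, heights_nodup hD hD2, ?_⟩
  cases ha : a i <;> rw [ha] at hcA hcD hcount <;> simp only [LR.side] at hcA hcD hcount <;>
    dsimp only
  · have h1 : ∀ e ∈ A i, e.2.2 = e.1.2 ∨ e.2.2 = e.1.2 + (b i).toInt := fun e he => by
      have := hcA e he
      have := hA2 e he
      omega
    have h2 : ∀ e ∈ D i, e.2.2 = e.1.2 := fun e he => by
      have := hcD e he
      have := hD2 e he
      omega
    exact ⟨List.forall_mem_map.2 h1, List.forall_mem_map.2 h2,
      hcount _ hA (fun e => hA' e.1 e.2) h1⟩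
  · have h1 : ∀ e ∈ D i, e.2.2 = e.1.2 ∨ e.2.2 = e.1.2 + (b i).toInt := fun e he => by
      have := hcD e he
      have := hD2 e he
      omega
    have h2 : ∀ e ∈ A i, e.2.2 = e.1.2 := fun e he => by
      have := hcA e he
      have := hA2 e he
      omega
    exact ⟨List.forall_mem_map.2 h2, List.forall_mem_map.2 h1,
      hcount _ hD (fun e => hD' e.1 e.2) h1⟩

theorem IsColumnDecomposition.columnContains_iff (hAD : IsColumnDecomposition E A D)
    (hE : (E : Set (Sym2 Vertex)) ⊆ (ryg ℓ r a b).edgeSet) (i : ℤ) (S T Dg : Set ℤ) :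
    ColumnContains (a i) (b i) (heights (A i)) (heights (D i)) S T Dg ↔
      ∀ e ∈ A i ++ D i, e.2 = partner (a i) (b i) i (columnSource (a i) S T) Dg e.1.2 := by
  have h := hAD.columnEdges hE i
  obtain ⟨-, -, hA', hD'⟩ := hAD i
  refine RailYard.columnContains_iff (fun e he => ((hA' e.1 e.2).1 he).2)
    (fun e he => ((hD' e.1 e.2).1 he).2) ?_
  have h2 := h.2.2
  cases ha : a i <;> rw [ha] at h2 <;> dsimp only at h2 ⊢
  · exact List.forall_mem_map.1 h2.2.1
  · exact List.forall_mem_map.1 h2.1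

namespace AdmissibleCovering

/-- Every edge of the graph has exactly one even endpoint, hence belongs to one column, so
containment can be checked column by column through the partners. -/
theorem contains_iff (hAD : IsColumnDecomposition E A D)
    (hE : (E : Set (Sym2 Vertex)) ⊆ (ryg ℓ r a b).edgeSet) (C : AdmissibleCovering ℓ r a b) :
    C.Contains E ↔ ∀ i, ℓ ≤ i → i ≤ r → ColumnContains (a i) (b i) (heights (A i)) (heights (D i))
      (C.colBlack i) (C.colBlack (i + 1)) (C.diagSet i) := by
  have hcol : ∀ i, ℓ ≤ i → i ≤ r → (ColumnContains (a i) (b i) (heights (A i)) (heights (D i))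
      (C.colBlack i) (C.colBlack (i + 1)) (C.diagSet i) ↔
        ∀ e ∈ A i ++ D i, C.dimers.Adj e.1 e.2) := fun i hi hr => by
    rw [hAD.columnContains_iff hE]
    refine forall₂_congr fun e he => ?_
    rw [(hAD.cases hE he).1, C.adj_iff hi hr]
  constructor
  · intro h i hi hr
    rw [hcol i hi hr]
    exact fun e he => h (hAD.mem_append_iff.1 he).1
  · intro h e he
    induction e using Sym2.ind with
    | h v w =>
    have key : ∀ v w, IsEdge ℓ r a b v w → s(v, w) ∈ E → C.dimers.Adj v w := by
      intro v w hvw he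
      have p := hvw.parity
      obtain ⟨i, y, hi, hr, rfl, -⟩ := hvw
      dsimp only at p
      exact (hcol i hi hr).1 (h i hi hr) ((2 * i, y), w)
        (hAD.mem_append_iff.2 ⟨he, rfl, p.2.2.2.2⟩)
    rcases ryg_adj.1 (hE he) with h1 | h1
    · exact key v w h1 he
    · exact (key w v h1 (Sym2.eq_swap ▸ he)).symm

theorem isPure_iff (C : AdmissibleCovering ℓ r a b) :
    C.IsPure ↔ C.leftState = vacuum ∧ C.rightState = vacuum := by
  rw [MayaDiagram.ext_iff, MayaDiagram.ext_iff, Set.ext_iff, Set.ext_iff, ← forall_and]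
  unfold IsPure BoundaryCondition
  refine forall_congr' fun y => ?_
  change _ ↔ ((2 * ℓ - 1, y) ∉ C.dimers.verts ↔ y < 0) ∧ ((2 * r + 1, y) ∈ C.dimers.verts ↔ y < 0)
  rw [Nat.cast_zero, neg_zero, ← not_lt]
  tauto

/-! ### Coverings as sequences of states -/

open Classical in
/-- The state of a covering on the abscissa `2 * i - 1`. -/
noncomputable def state (C : AdmissibleCovering ℓ r a b) (i : ℤ) : MayaDiagram :=
  if h : ∃ m : MayaDiagram, m.black = C.colBlack i then h.choose else vacuum

theorem state_black (C : AdmissibleCovering ℓ r a b) {i : ℤ} (hi : ℓ ≤ i) (hr : i ≤ r + 1) :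
    (C.state i).black = C.colBlack i := by
  have h := C.exists_state hi hr
  rw [state, dif_pos h]
  exact h.choose_spec

/-- The sequence of the states of a covering. -/
noncomputable def states (C : AdmissibleCovering ℓ r a b) (j : Fin ((r - ℓ + 1).toNat + 1)) :
    MayaDiagram :=
  C.state (ℓ + (j : ℕ))

theorem states_injective : Function.Injective (states : AdmissibleCovering ℓ r a b → _) := by
  intro C C' h
  refine eq_of_colBlack_eq fun i hi hr => ?_
  rw [← state_black C hi hr, ← state_black C' hi hr]
  have := congrFun h ⟨(i - ℓ).toNat, by omega⟩
  unfold states at this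
  dsimp only at this
  rw [Int.toNat_of_nonneg (by omega), add_sub_cancel] at this
  rw [this]

end AdmissibleCovering

variable (a b A D ℓ) in
/-- The possible pairs of states around the `j`-th column of a covering containing `E`. -/
def colRel (j : ℕ) (m m' : MayaDiagram) : Prop :=
  ColumnRel (a (ℓ + j)) (b (ℓ + j)) (heights (A (ℓ + j))) (heights (D (ℓ + j))) m m'

variable (a b ℓ) in
/-- The exponent of the contribution of the `j`-th column. -/
noncomputable def colWeight (j : ℕ) (m m' : MayaDiagram) : ℤ →₀ ℕ :=
  Finsupp.single (ℓ + j) (stripWeight (a (ℓ + j)) (b (ℓ + j)) m m')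

namespace AdmissibleCovering

theorem states_isStateChain (hAD : IsColumnDecomposition E A D)
    (hE : (E : Set (Sym2 Vertex)) ⊆ (ryg ℓ r a b).edgeSet) {C : AdmissibleCovering ℓ r a b}
    (hC : C.Contains E) : IsStateChain (colRel ℓ a b A D) C.states := by
  intro j
  have hi : ℓ ≤ ℓ + (j : ℕ) := by omega
  have hr : ℓ + (j : ℕ) ≤ r := by omega
  have e : C.states j.succ = C.state (ℓ + (j : ℕ) + 1) := by
    unfold states
    rw [Fin.val_succ, Nat.cast_succ, add_assoc]
  have e' : C.states j.castSucc = C.state (ℓ + (j : ℕ)) := rfl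
  unfold colRel ColumnRel
  rw [e, e', C.state_black hi (by omega), C.state_black (by omega) (by omega)]
  exact ⟨_, C.columnStrip hi hr, (contains_iff hAD hE C).1 hC _ hi hr⟩

/-- With `states_injective` and `states_isStateChain`, this makes coverings containing `E`
equivalent to chains of states. -/
theorem exists_states_eq (hlr : ℓ ≤ r) (hAD : IsColumnDecomposition E A D)
    (hE : (E : Set (Sym2 Vertex)) ⊆ (ryg ℓ r a b).edgeSet)
    {s : Fin ((r - ℓ + 1).toNat + 1) → MayaDiagram} (hs : IsStateChain (colRel ℓ a b A D) s) :
    ∃ C : AdmissibleCovering ℓ r a b, C.Contains E ∧ C.states = s := by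
  -- An extension of `s` to all integers; its values outside `[ℓ .. r + 1]` are irrelevant.
  let st : ℤ → MayaDiagram := fun i => s (Fin.ofNat _ (i - ℓ).toNat)
  have hst : ∀ j : Fin ((r - ℓ + 1).toNat + 1), st (ℓ + (j : ℕ)) = s j := fun j => by
    change s _ = s j
    congr 1
    refine Fin.ext ?_
    rw [Fin.val_ofNat, add_sub_cancel_left, Int.toNat_natCast, Nat.mod_eq_of_lt j.2]
  have hrel : ∀ i, ℓ ≤ i → i ≤ r →
      ColumnRel (a i) (b i) (heights (A i)) (heights (D i)) (st i) (st (i + 1)) := by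
    intro i hi hr
    obtain ⟨j, rfl⟩ : ∃ j : ℕ, i = ℓ + j := ⟨(i - ℓ).toNat, by omega⟩
    have h := hs ⟨j, by omega⟩
    rw [← hst, ← hst, Fin.val_succ, Nat.cast_succ, ← add_assoc] at h
    exact h
  choose! Dg hDg hcont using hrel
  have hcol := fun i hi hr => colBlack_ofStates hlr st Dg hDg (i := i) hi hr
  refine ⟨ofStates hlr st Dg hDg, (contains_iff hAD hE _).2 fun i hi hr => ?_, ?_⟩
  · have h1 := (ofStates hlr st Dg hDg).columnStrip hi hr
    rw [hcol i hi (by omega), hcol (i + 1) (by omega) (by omega)] at h1 ⊢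
    -- The diagonals of the constructed covering are the chosen ones, being a strip between the same
    -- states.
    rw [h1.unique (hDg i hi hr)]
    exact hcont i hi hr
  · ext1 j
    rw [← hst]
    refine MayaDiagram.ext ?_
    unfold states
    rw [state_black _ (by omega) (by omega), hcol _ (by omega) (by omega)]

/-- The number of diagonal dimers in a column depends only on its two states, again by uniqueness of
the strip. -/
theorem weight_eq {R : Type*} [CommRing R] (C : AdmissibleCovering ℓ r a b) :
    C.weight R = MvPowerSeries.monomial (chainWeight (colWeight ℓ a b) C.states) 1 := by
  have hmon : ∀ (t : Finset (Fin (r - ℓ + 1).toNat)) (f : Fin (r - ℓ + 1).toNat → ℤ →₀ ℕ),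
      (MvPowerSeries.monomial (∑ j ∈ t, f j) (1 : R) : MvPowerSeries ℤ R) =
        ∏ j ∈ t, MvPowerSeries.monomial (f j) (1 : R) := by
    intro t f
    induction t using Finset.cons_induction with
    | empty => simp
    | cons j t hj ih =>
      rw [Finset.sum_cons, Finset.prod_cons, ← ih, MvPowerSeries.monomial_mul_monomial, one_mul]
  rw [chainWeight, hmon, weight]
  symm
  refine Finset.prod_bij (fun j _ => ℓ + (j : ℕ)) ?_ ?_ ?_ ?_
  · intro j _
    rw [Finset.mem_Icc]
    omega
  · intro j _ j' _ h
    exact Fin.ext (by omega)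
  · intro i hi
    rw [Finset.mem_Icc] at hi
    exact ⟨⟨(i - ℓ).toNat, by omega⟩, Finset.mem_univ _, by dsimp only; omega⟩
  · intro j _
    have hi : ℓ ≤ ℓ + (j : ℕ) := by omega
    have hr : ℓ + (j : ℕ) ≤ r := by omega
    have e : C.states j.succ = C.state (ℓ + (j : ℕ) + 1) := by
      unfold states
      rw [Fin.val_succ, Nat.cast_succ, add_assoc]
    have e' : C.states j.castSucc = C.state (ℓ + (j : ℕ)) := rfl
    have h := C.columnStrip hi hr
    rw [← C.state_black hi (by omega), ← C.state_black (i := ℓ + (j : ℕ) + 1) (by omega) (by omega)]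
      at h
    rw [MvPowerSeries.X_pow_eq, C.diagCount_eq, h.ncard_eq, colWeight, e, e']

theorem states_zero (hlr : ℓ ≤ r) (C : AdmissibleCovering ℓ r a b) : C.states 0 = C.leftState := by
  refine MayaDiagram.ext ?_
  rw [← C.colBlack_left, states, state_black _ (by simp) (by simp; omega)]
  simp

theorem states_last (hlr : ℓ ≤ r) (C : AdmissibleCovering ℓ r a b) :
    C.states (Fin.last _) = C.rightState := by
  refine MayaDiagram.ext ?_
  have h : ℓ + ((Fin.last (r - ℓ + 1).toNat : Fin _) : ℕ) = r + 1 := by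
    rw [Fin.val_last]
    omega
  rw [← C.colBlack_right hlr, states, h, state_black _ (by omega) le_rfl]

end AdmissibleCovering

/-! ### Summation over coverings -/

theorem hasSum_subtype_congr {α β : Type*} [AddCommMonoid β] [TopologicalSpace β] {p q : α → Prop}
    (h : ∀ x, p x ↔ q x) {f : α → β} {s : β} (hs : HasSum (fun x : {x // q x} => f x) s) :
    HasSum (fun x : {x // p x} => f x) s := by
  obtain rfl : p = q := funext fun x => propext (h x)
  exact hs

/-- Convergence is tested coefficient by coefficient, and in each degree only finitely many
coverings contribute, so any topology on `R` will do. The sum is then transported to chains of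
states along the injection `states`. -/
theorem hasSum_weight {R : Type*} [CommRing R] [TopologicalSpace R] (hlr : ℓ ≤ r)
    (hE : (E : Set (Sym2 Vertex)) ⊆ (ryg ℓ r a b).edgeSet) (hAD : IsColumnDecomposition E A D)
    (lst rst : MayaDiagram) :
    HasSum
      (fun C : {C : AdmissibleCovering ℓ r a b //
        C.leftState = lst ∧ C.rightState = rst ∧ C.Contains E} => C.1.weight R)
      (braket lst (orderedProd ℓ r (transfer R a b E A D)) rst) := by
  classical
  -- The expansion into chains requires `1 ≠ 0`; over the zero ring all series vanish.
  rcases subsingleton_or_nontrivial R with hR | hR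
  · have h0 : ∀ f : MvPowerSeries ℤ R, f = 0 := fun f => by
      ext n
      exact Subsingleton.elim _ _
    rw [h0 (braket _ _ _)]
    convert! hasSum_zero with C
    exact h0 _
  refine Pi.hasSum.2 fun n => ?_
  obtain ⟨F, hF, hFsum⟩ := exists_coeff_prod_eq_sum (R := R)
    (T := fun j => transfer R a b E A D (ℓ + j)) (rel := colRel ℓ a b A D)
    (wt := colWeight ℓ a b) (K := (r - ℓ + 1).toNat)
    (fun j _ n l r => coeff_transfer_apply (hAD.columnEdges hE (ℓ + j)) n l r) _ le_rfl rst n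
  let f : (Fin ((r - ℓ + 1).toNat + 1) → MayaDiagram) → R := fun s =>
    if s ∈ F ∧ s 0 = lst then 1 else 0
  let Φ : {C : AdmissibleCovering ℓ r a b //
      C.leftState = lst ∧ C.rightState = rst ∧ C.Contains E} →
      (Fin ((r - ℓ + 1).toNat + 1) → MayaDiagram) := fun C => C.1.states
  have hΦ : Function.Injective Φ :=
    AdmissibleCovering.states_injective.comp Subtype.val_injective
  have hfΦ : (fun C : {C : AdmissibleCovering ℓ r a b //
      C.leftState = lst ∧ C.rightState = rst ∧ C.Contains E} => C.1.weight R n) = f ∘ Φ := by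
    funext C
    obtain ⟨C, hl, hr, hC⟩ := C
    change MvPowerSeries.coeff n (C.weight R) = _
    rw [C.weight_eq, MvPowerSeries.coeff_monomial]
    refine if_congr ?_ rfl rfl
    rw [hF]
    have h1 := AdmissibleCovering.states_isStateChain hAD hE hC
    have h2 := (C.states_zero hlr).trans hl
    have h3 := (C.states_last hlr).trans hr
    constructor
    · exact fun h => ⟨⟨h1, h3, h.symm⟩, h2⟩
    · exact fun h => h.1.2.2.symm
  have hbra : braket lst (orderedProd ℓ r (transfer R a b E A D)) rst n = ∑ s ∈ F, f s := by
    change MvPowerSeries.coeff n (orderedProd ℓ r (transfer R a b E A D) : FormalOp R)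
      (ket R rst) lst = _
    unfold orderedProd
    rw [hFsum, Finsupp.finsetSum_apply]
    refine Finset.sum_congr rfl fun s hs => ?_
    rw [ket_apply]
    exact if_congr (and_iff_right hs).symm rfl rfl
  change HasSum (fun C : {C : AdmissibleCovering ℓ r a b //
      C.leftState = lst ∧ C.rightState = rst ∧ C.Contains E} => C.1.weight R n) _
  rw [hfΦ, hbra, hΦ.hasSum_iff]
  · exact hasSum_sum_of_ne_finset_zero fun s hs => if_neg fun h => hs h.1
  -- A chain with a nonzero term has the prescribed ends and comes from a covering containing `E`,
  -- so it lies in the range of `Φ`.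
  · intro s hs
    refine if_neg fun h => hs ?_
    obtain ⟨h1, h2, -⟩ := (hF s).1 h.1
    obtain ⟨C, hC, rfl⟩ := AdmissibleCovering.exists_states_eq hlr hAD hE h1
    exact ⟨⟨C, (C.states_zero hlr).symm.trans h.2, (C.states_last hlr).symm.trans h2, hC⟩, rfl⟩

end RailYard

theorem theorem4 {R : Type*} [CommRing R] [TopologicalSpace R]
    (ℓ r : ℤ) (hℓr : ℓ ≤ r) (a : ℤ → LR) (b : ℤ → Sgn)
    (E : Finset (Sym2 Vertex)) (hE : (E : Set (Sym2 Vertex)) ⊆ (ryg ℓ r a b).edgeSet)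
    (A D : ℤ → List (Vertex × Vertex)) (hAD : IsColumnDecomposition E A D) :
    HasSum
      (fun C : {C : AdmissibleCovering ℓ r a b // C.IsPure ∧ C.Contains E} => C.1.weight R)
      (braket vacuum (orderedProd ℓ r (transfer R a b E A D)) vacuum) ∧
    ∀ lst rst : MayaDiagram,
      HasSum
        (fun C : {C : AdmissibleCovering ℓ r a b //
          C.leftState = lst ∧ C.rightState = rst ∧ C.Contains E} => C.1.weight R)
        (braket lst (orderedProd ℓ r (transfer R a b E A D)) rst) := by
  refine ⟨?_, hasSum_weight hℓr hE hAD⟩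
  have h := hasSum_weight (R := R) hℓr hE hAD vacuum vacuum
  have hpure : ∀ C : AdmissibleCovering ℓ r a b,
      (C.IsPure ∧ C.Contains E) ↔ C.leftState = vacuum ∧ C.rightState = vacuum ∧ C.Contains E :=
    fun C => by rw [C.isPure_iff, and_assoc]
  exact hasSum_subtype_congr (f := fun C => C.weight R) hpure h
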